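/- Let $X\subseteq\mathbb R^M$ be an orthant space of dimension $m$. That is, write $U=\{u_1,\dots,u_M\}$ for the standard basis; for $E\subseteq U$ let $\mathcal O(E)=\{\sum_{u\in E}\lambda_u u:\lambda_u>0\}$, let $\mathbb R(E)$ be the span of $E$, and let $P_E$ be the orthogonal projection of $\mathbb R^M$ onto $\mathbb R(E)$. Then $X$ is a union of open orthants $\mathcal O(E)$ (its strata) of maximal dimension $m$, contains with each orthant all orthants in its closure, contains every orthant $\mathcal O(E)$ all of whose faces of dimension at most two lie in $X$, and carries the intrinsic metric $d$ (infimum of Euclidean lengths of piecewise linear paths in $X$). Any two points of $X$ are joined by a unique geodesic. For $x,x'\in X$ let $\log_{x'}(x)\in\mathbb R^M$ be the initial tangent vector, of norm $d(x',x)$, of the geodesic from $x'$ to $x$, and put $\Phi(x;x')=\log_{x'}(x)+x'$. For a vector $w$ in the tangent cone at $x^*$, let $x^*(\lambda,w)$ be the point at distance $\lambda\|w\|$ along the geodesic starting at $x^*$ with initial tangent vector $w$ (defined for all sufficiently small $\lambda>0$). Let $E(x)$ be the set of axes along which $x$ has a positive coordinate, and let $E(x_1,x_2)$ consist of the axes in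 $E(x_1)\cap E(x_2)$, the axes $e\in E(x_1)$ with $\mathcal O(\{e\}\cup E(x_2))\subseteq X$, and the axes $e\in E(x_2)$ with $\mathcal O(\{e\}\cup E(x_1))\subseteq X$. The carrier of a geodesic is the sequence $(\mathcal O_0,\dots,\mathcal O_k)$ of the distinct strata that it successively meets in a segment of positive length. The support of the geodesic from $x_1$ to $x_2$ is the pair of sequences $\mathcal A=(A_0,\dots,A_k)$, $\mathcal B=(B_0,\dots,B_k)$ of sets of axes, where $A_0=B_0=E(x_1,x_2)$ and, for $1\le i\le k$, $A_i$ is the set of axes lost and $B_i$ the set of axes gained on passing from $\mathcal O_{i-1}$ to $\mathcal O_i$, so that $\mathcal O_i=\mathcal O(B_0\cup\dots\cup B_i\cup A_{i+1}\cup\dots\cup A_k)$. Theorem. Let $\sigma=\mathcal O(E)$ be a stratum of $X$, let $x^*\in\sigma$, and let $x$ be any point of $X$. (i) If $w\in\mathbb R(E)$, then $\lim_{\lambda\to0+}\Phi(x;x^*(\lambda,w))=\Phi(x;x^*)$. (ii) Let $F\neq\emptyset$ be disjoint from $E$ with $\tau=\mathcal O(E\cup F)$ a stratum of $X$, and let $w_\tau\in\mathbb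 R(E)\times\mathcal O(F)$. Then the limit $$\Psi(x,w_\tau;x^*)=\lim_{\lambda\to0+}\Phi(x;x^*(\lambda,w_\tau))$$ exists. Moreover there are $\epsilon>0$ and sequences $\mathcal A=(A_0,\dots,A_k)$, $\mathcal B=(B_0,\dots,B_k)$ of sets of axes such that, for every $\lambda\in(0,\epsilon)$, $(\mathcal A,\mathcal B)$ is the support of the geodesic from $x^*(\lambda,w_\tau)$ to $x$; and, with $W_i=P_{A_i\cap E}(x^*)$ if this vector is non-zero and $W_i=P_{A_i\cap F}(w_\tau)$ otherwise, all $W_i$ $(1\le i\le k)$ are non-zero and $$\Psi(x,w_\tau;x^*)=P_{B_0}(x)-\sum_{i=1}^k\frac{\|P_{B_i}(x)\|}{\|W_i\|}\,W_i .$$ -/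

import Mathlib

open Filter Topology

noncomputable section

/-- The open positive orthant `O(E)` of `ℝ^M` spanned by the standard basis vectors `u_i`, `i ∈ E`. -/
def openOrthant {M : ℕ} (E : Finset (Fin M)) : Set (EuclideanSpace ℝ (Fin M)) :=
  {x | (∀ i ∈ E, 0 < x i) ∧ ∀ i ∉ E, x i = 0}

/-- The coordinate subspace `ℝ(E)` of `ℝ^M`. -/
def coordSpan {M : ℕ} (E : Finset (Fin M)) : Set (EuclideanSpace ℝ (Fin M)) :=
  {w | ∀ i ∉ E, w i = 0}

/-- The open stratum `ℝ(E) × O(F)` of the tangent cone at a point of `O(E)`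
(for disjoint `E`, `F`), as a subset of `ℝ^M`. -/
def tangentStratum {M : ℕ} (E F : Finset (Fin M)) : Set (EuclideanSpace ℝ (Fin M)) :=
  {w | (∀ i ∈ F, 0 < w i) ∧ ∀ i ∉ E ∪ F, w i = 0}

/-- The orthogonal projection `P_A` onto `ℝ(A)`, with its value placed in `ℝ^M`. -/
def coordProj {M : ℕ} (A : Finset (Fin M)) (x : EuclideanSpace ℝ (Fin M)) :
    EuclideanSpace ℝ (Fin M) :=
  WithLp.toLp 2 (fun i => if i ∈ A then x i else 0)

/-- The set `E(x)` of axes along which `x` has a positive coordinate. -/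
def posAxes {M : ℕ} (x : EuclideanSpace ℝ (Fin M)) : Finset (Fin M) :=
  Finset.univ.filter (fun i => 0 < x i)

/-- An orthant space of dimension `m` in `ℝ^M`, given by the axis sets of its orthants. -/
structure OrthantSpace (M m : ℕ) where
  /-- the sets `E` of axes for which `O(E)` is one of the orthants -/
  strata : Finset (Finset (Fin M))
  /-- the orthants in the closure of an orthant of the space belong to the space -/
  closure_mem : ∀ E ∈ strata, ∀ G ⊆ E, G ∈ strata
  /-- an orthant all of whose faces of dimension at most two belong to the space belongs to it -/
  flag : ∀ E : Finset (Fin M), (∀ G ⊆ E, G.card ≤ 2 → G ∈ strata) → E ∈ strata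
  /-- the maximal dimension of an orthant is `m` -/
  dim_eq : IsGreatest (Finset.card '' (strata : Set (Finset (Fin M)))) m

namespace OrthantSpace

/-- The underlying set of the space: the union of its orthants. -/
def carrier {M m : ℕ} (X : OrthantSpace M m) : Set (EuclideanSpace ℝ (Fin M)) :=
  ⋃ E ∈ X.strata, openOrthant E

/-- The intrinsic metric: the infimum of the Euclidean lengths of the piecewise linear paths
in the space (given by their successive vertices `v 0, …, v n`) joining `p` to `q`. -/
def idist {M m : ℕ} (X : OrthantSpace M m) (p q : EuclideanSpace ℝ (Fin M)) : ℝ :=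
  sInf {L : ℝ | ∃ (n : ℕ) (v : ℕ → EuclideanSpace ℝ (Fin M)), v 0 = p ∧ v n = q ∧
    (∀ i < n, segment ℝ (v i) (v (i + 1)) ⊆ X.carrier) ∧
    L = ∑ i ∈ Finset.range n, ‖v (i + 1) - v i‖}

/-- `γ`, restricted to `[0, a]`, is a geodesic of the space with constant speed `c`. -/
def IsGeodesicOn {M m : ℕ} (X : OrthantSpace M m) (γ : ℝ → EuclideanSpace ℝ (Fin M))
    (a c : ℝ) : Prop :=
  (∀ s ∈ Set.Icc 0 a, γ s ∈ X.carrier) ∧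
    ∀ s ∈ Set.Icc 0 a, ∀ t ∈ Set.Icc 0 a, X.idist (γ s) (γ t) = c * |s - t|

/-- The geodesic `[0, 1] → X` from `p` to `q`, of constant speed `d(p, q)`. (It exists and is
unique because the space is CAT(0); the values outside `[0, 1]` play no role.) -/
def geodesic {M m : ℕ} (X : OrthantSpace M m) (p q : EuclideanSpace ℝ (Fin M)) :
    ℝ → EuclideanSpace ℝ (Fin M) :=
  Classical.epsilon (fun γ => X.IsGeodesicOn γ 1 (X.idist p q) ∧ γ 0 = p ∧ γ 1 = q)

/-- The logarithm map `log_{p}(x)`: the initial tangent vector, of norm `d(p, x)`, of the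
geodesic from `p` to `x`. -/
def log {M m : ℕ} (X : OrthantSpace M m) (p x : EuclideanSpace ℝ (Fin M)) :
    EuclideanSpace ℝ (Fin M) :=
  derivWithin (X.geodesic p x) (Set.Icc 0 1) 0

/-- The translated logarithm map `Φ(x; p) = log_{p}(x) + p`. -/
def translatedLog {M m : ℕ} (X : OrthantSpace M m) (x p : EuclideanSpace ℝ (Fin M)) :
    EuclideanSpace ℝ (Fin M) :=
  X.log p x + p

/-- `p(lam, w)`: the point at distance `lam * ‖w‖` from `p` along the geodesic that starts at `p`
with initial tangent vector `w`. (For `w` in the tangent cone at `p` it is uniquely determined as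
soon as `lam` is sufficiently small and positive.) -/
def pointAlong {M m : ℕ} (X : OrthantSpace M m) (p : EuclideanSpace ℝ (Fin M)) (lam : ℝ)
    (w : EuclideanSpace ℝ (Fin M)) : EuclideanSpace ℝ (Fin M) :=
  Classical.epsilon (fun q => ∃ γ : ℝ → EuclideanSpace ℝ (Fin M),
    X.IsGeodesicOn γ lam ‖w‖ ∧ γ 0 = p ∧ HasDerivWithinAt γ w (Set.Icc 0 lam) 0 ∧ γ lam = q)

/-- The set `E(p, q)` of axes: those in `E(p) ∩ E(q)`, those in `E(p)` that are compatible with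
`E(q)`, and those in `E(q)` that are compatible with `E(p)`. -/
def commonAxes {M m : ℕ} (X : OrthantSpace M m) (p q : EuclideanSpace ℝ (Fin M)) :
    Finset (Fin M) :=
  (posAxes p ∩ posAxes q) ∪ (posAxes p).filter (fun e => insert e (posAxes q) ∈ X.strata) ∪
    (posAxes q).filter (fun e => insert e (posAxes p) ∈ X.strata)

/-- `O 0, …, O k` are the axis sets of the carrier of the path `γ : [0, 1] → X`: the pairwise
distinct strata that `γ` successively meets along an interval of positive length. -/
def IsCarrier {M k : ℕ} (γ : ℝ → EuclideanSpace ℝ (Fin M)) (O : Fin (k + 1) → Finset (Fin M)) :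
    Prop :=
  Function.Injective O ∧ ∃ t : Fin (k + 2) → ℝ, StrictMono t ∧ t 0 = 0 ∧ t (Fin.last (k + 1)) = 1 ∧
    ∀ i : Fin (k + 1), ∀ s ∈ Set.Ioo (t i.castSucc) (t i.succ), γ s ∈ openOrthant (O i)

/-- The axis set `B_0 ∪ … ∪ B_i ∪ A_{i+1} ∪ … ∪ A_k`. -/
def stageAxes {M k : ℕ} (A B : Fin (k + 1) → Finset (Fin M)) (i : Fin (k + 1)) :
    Finset (Fin M) :=
  (Finset.univ.filter (fun j => j ≤ i)).biUnion B ∪ (Finset.univ.filter (fun j => i < j)).biUnion A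

/-- `(A, B)` is the support of the geodesic from `p` to `q`: `A_0 = B_0 = E(p, q)`, the strata
`O_i = O(B_0 ∪ … ∪ B_i ∪ A_{i+1} ∪ … ∪ A_k)` form the carrier of the geodesic, and for `i > 0`
`A_i` consists of the axes lost, `B_i` of the axes gained, on passing from `O_{i-1}` to `O_i`. -/
def IsSupport {M m k : ℕ} (X : OrthantSpace M m) (p q : EuclideanSpace ℝ (Fin M))
    (A B : Fin (k + 1) → Finset (Fin M)) : Prop :=
  A 0 = X.commonAxes p q ∧ B 0 = X.commonAxes p q ∧
    IsCarrier (X.geodesic p q) (stageAxes A B) ∧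
    ∀ i : Fin k, A i.succ = stageAxes A B i.castSucc \ stageAxes A B i.succ ∧
      B i.succ = stageAxes A B i.succ \ stageAxes A B i.castSucc

end OrthantSpace

open Classical in
/-- The vector `W` attached to a set `A` of axes: `P_{A ∩ E}(p)`, or `P_{A ∩ F}(w)` when the
former vanishes. -/
def limitBlock {M : ℕ} (E F : Finset (Fin M)) (p w : EuclideanSpace ℝ (Fin M))
    (A : Finset (Fin M)) : EuclideanSpace ℝ (Fin M) :=
  if coordProj (A ∩ E) p = 0 then coordProj (A ∩ F) w else coordProj (A ∩ E) p

end

/-! ### Piecewise linear paths and the intrinsic metric. -/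

noncomputable section

namespace OrthantSpace

/-! The proof rests on an explicit form of the geodesic from `p` to `q`. Off the common axes `E(p,
q)`, the lost axes of `p` and the gained axes of `q` form a bipartite graph, with incompatible axes
joined and squared coordinates as weights. Cutting it along maximum-weight independent sets gives
blocks `(A_i, B_i)` of increasing ratio `‖P_{A_i} p‖ / ‖P_{B_i} q‖` (`exists_isRatioSystem`,
`exists_isBlockSystem`). The candidate path is affine on the common axes; the block `A_i` shrinks to
zero at a time `t_i`, and `B_i` starts to grow at that time.

Minimality is a calibration argument (`IsCalibration`). The velocity covector `ζ` of the candidate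
has norm at most its length `L` on every orthant, which is the extremality of the blocks, and `⟨ζ, q
- p⟩ = L ^ 2`. So no piecewise linear path is shorter than `L`, and the equality case determines the
path coordinate by coordinate. This yields existence and uniqueness of geodesics without any appeal
to CAT(0) theory. Reading off the initial velocity gives `Φ(q; p) = P_{B_0} q - ∑ (‖P_{B_i} q‖ /
‖P_{A_i} p‖) P_{A_i} p` (`translatedLog_eq`).

The conditions on blocks consist of combinatorial clauses, which see only the strata of `p` and `q`,
and finitely many polynomial inequalities in the coordinates. Along `x* + λ w` the stratum is fixed
for small `λ > 0`, and a polynomial in `λ` has constant sign on some `(0, ε)`. As there are finitely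
many candidates, one block system serves all small `λ` (`exists_eventually_isGeodesicBlocks`), and
the limit may be taken termwise. In (i) the weak inequalities persist at `λ = 0`, so the same blocks
compute `Φ(x; x*)`. In (ii) a block either keeps its part from `x*` or lies in `F`, and then `λ`
cancels from the normalised vector (`limitBlock_spec`). Strict inequality of the ratios is kept
apart (`BlocksStrict`): it can fail in the limit, and only the description of the support needs it.
-/

theorem mem_openOrthant_posAxes {M : ℕ} {y : EuclideanSpace ℝ (Fin M)} (h : ∀ i, 0 ≤ y i) :
    y ∈ openOrthant (posAxes y) := by
  refine ⟨fun i hi => by simpa [posAxes] using hi, fun i hi => ?_⟩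
  have : ¬ 0 < y i := by simpa [posAxes] using hi
  exact le_antisymm (not_lt.1 this) (h i)

theorem posAxes_eq_of_mem {M : ℕ} {y : EuclideanSpace ℝ (Fin M)} {E : Finset (Fin M)}
    (h : y ∈ openOrthant E) : posAxes y = E := by
  ext i
  simp only [posAxes, Finset.mem_filter, Finset.mem_univ, true_and]
  refine ⟨fun hi => ?_, h.1 i⟩
  by_contra hE
  exact hi.ne' (h.2 i hE)

theorem nonneg_of_mem_openOrthant {M : ℕ} {y : EuclideanSpace ℝ (Fin M)} {E : Finset (Fin M)}
    (h : y ∈ openOrthant E) (i : Fin M) : 0 ≤ y i := by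
  by_cases hi : i ∈ E
  · exact (h.1 i hi).le
  · exact (h.2 i hi).ge

variable {M m : ℕ} (X : OrthantSpace M m)

theorem mem_carrier_iff {y : EuclideanSpace ℝ (Fin M)} :
    y ∈ X.carrier ↔ (∀ i, 0 ≤ y i) ∧ posAxes y ∈ X.strata := by
  simp only [carrier, Set.mem_iUnion, exists_prop]
  constructor
  · rintro ⟨E, hE, hy⟩
    exact ⟨nonneg_of_mem_openOrthant hy, (posAxes_eq_of_mem hy).symm ▸ hE⟩
  · rintro ⟨h, hy⟩
    exact ⟨_, hy, mem_openOrthant_posAxes h⟩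

theorem mem_posAxes {y : EuclideanSpace ℝ (Fin M)} {i : Fin M} : i ∈ posAxes y ↔ 0 < y i := by
  simp [posAxes]

variable {X}

theorem segment_subset_carrier {p q : EuclideanSpace ℝ (Fin M)} (hp : ∀ i, 0 ≤ p i)
    (hq : ∀ i, 0 ≤ q i) (h : posAxes p ∪ posAxes q ∈ X.strata) :
    segment ℝ p q ⊆ X.carrier := by
  rintro y ⟨a, b, ha, hb, -, rfl⟩
  rw [mem_carrier_iff]
  refine ⟨fun i => ?_, X.closure_mem _ h _ fun i hi => ?_⟩
  · have := mul_nonneg ha (hp i)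
    have := mul_nonneg hb (hq i)
    simp; linarith
  · simp only [mem_posAxes, Finset.mem_union] at hi ⊢
    by_contra! hn
    have h1 : p i = 0 := le_antisymm hn.1 (hp i)
    have h2 : q i = 0 := le_antisymm hn.2 (hq i)
    simp [h1, h2] at hi

/-- The midpoint is positive on every axis on which one of the ends is, so its own stratum already
has the union as a face. -/
theorem union_posAxes_mem {p q : EuclideanSpace ℝ (Fin M)} (h : segment ℝ p q ⊆ X.carrier) :
    posAxes p ∪ posAxes q ∈ X.strata := by
  have hp := (X.mem_carrier_iff.1 (h (left_mem_segment ℝ p q))).1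
  have hq := (X.mem_carrier_iff.1 (h (right_mem_segment ℝ p q))).1
  have hm := (X.mem_carrier_iff.1 (h (a := (1/2 : ℝ) • p + (1/2 : ℝ) • q)
    ⟨1/2, 1/2, by norm_num, by norm_num, by norm_num, rfl⟩)).2
  refine X.closure_mem _ hm _ fun i hi => ?_
  simp only [mem_posAxes, Finset.mem_union] at hi ⊢
  simp only [PiLp.add_apply, PiLp.smul_apply, smul_eq_mul]
  have := hp i
  have := hq i
  rcases hi with hi | hi <;> linarith

variable (X) in
/-- `PLPath X p q l`: a piecewise linear path of length `l` in `X` joins `p` to `q`. -/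
inductive PLPath (p : EuclideanSpace ℝ (Fin M)) : EuclideanSpace ℝ (Fin M) → ℝ → Prop
  | refl : PLPath p p 0
  | step {q r : EuclideanSpace ℝ (Fin M)} {l : ℝ} : PLPath p q l →
      segment ℝ q r ⊆ X.carrier → PLPath p r (l + ‖r - q‖)

/-- The inductive form allows estimates along a path to be proved one segment at a time. -/
theorem plPath_iff {p q : EuclideanSpace ℝ (Fin M)} {L : ℝ} :
    PLPath X p q L ↔ ∃ (n : ℕ) (v : ℕ → EuclideanSpace ℝ (Fin M)), v 0 = p ∧ v n = q ∧
      (∀ i < n, segment ℝ (v i) (v (i + 1)) ⊆ X.carrier) ∧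
      L = ∑ i ∈ Finset.range n, ‖v (i + 1) - v i‖ := by
  constructor
  · intro h
    induction h with
    | refl => exact ⟨0, fun _ => p, rfl, rfl, by simp, by simp⟩
    | @step q r l _ hs ih =>
      obtain ⟨n, v, h0, hn, hv, rfl⟩ := ih
      refine ⟨n + 1, fun i => if i ≤ n then v i else r, by simp [h0], by simp, ?_, ?_⟩
      · intro i hi
        rcases Nat.lt_succ_iff_lt_or_eq.1 hi with hi | rfl
        · simpa [hi.le, Nat.succ_le_of_lt hi] using hv i hi
        · simpa [hn] using hs
      · rw [Finset.sum_range_succ]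
        simp only [le_refl, if_true, hn, Nat.not_succ_le_self, if_false, add_left_inj]
        refine Finset.sum_congr rfl fun i hi => ?_
        have := Finset.mem_range.1 hi
        simp [this.le, Nat.succ_le_of_lt this]
  · rintro ⟨n, v, rfl, rfl, hv, rfl⟩
    induction n with
    | zero => simpa using PLPath.refl (X := X) (p := v 0)
    | succ n ih =>
      rw [Finset.sum_range_succ]
      exact (ih fun i hi => hv i (hi.trans n.lt_succ_self)).step (hv n n.lt_succ_self)

theorem idist_eq (p q : EuclideanSpace ℝ (Fin M)) :
    X.idist p q = sInf {L | PLPath X p q L} := by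
  simp only [idist, plPath_iff]

namespace PLPath

variable {p q r : EuclideanSpace ℝ (Fin M)} {l l' : ℝ}

theorem single (h : segment ℝ p q ⊆ X.carrier) : PLPath X p q ‖q - p‖ := by
  simpa using (PLPath.refl (p := p)).step h

theorem trans (h : PLPath X p q l) (h' : PLPath X q r l') : PLPath X p r (l + l') := by
  induction h' with
  | refl => simpa using h
  | step _ hs ih => rw [← add_assoc]; exact ih.step hs

theorem symm (h : PLPath X p q l) : PLPath X q p l := by
  induction h with
  | refl => exact PLPath.refl
  | @step q r l _ hs ih =>
    rw [segment_symm] at hs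
    rw [add_comm, norm_sub_rev]
    exact (single hs).trans ih

theorem norm_sub_le (h : PLPath X p q l) : ‖q - p‖ ≤ l := by
  induction h with
  | refl => simp
  | @step q r l _ _ ih =>
    have := norm_add_le (r - q) (q - p)
    rw [sub_add_sub_cancel] at this
    linarith

theorem idist_le (h : PLPath X p q l) : X.idist p q ≤ l := by
  rw [idist_eq]
  exact csInf_le ⟨0, fun l hl => (norm_nonneg _).trans hl.norm_sub_le⟩ h

end PLPath

/-- The space is a cone, so two segments through the origin suffice. Nonemptiness matters because
`sInf ∅ = 0` would spoil every lower bound on the distance. -/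
theorem exists_plPath {p q : EuclideanSpace ℝ (Fin M)} (hp : p ∈ X.carrier) (hq : q ∈ X.carrier) :
    ∃ l, PLPath X p q l := by
  have h0 : posAxes (0 : EuclideanSpace ℝ (Fin M)) = ∅ := by
    ext i; simp [mem_posAxes]
  rw [mem_carrier_iff] at hp hq
  have h1 : segment ℝ p 0 ⊆ X.carrier :=
    segment_subset_carrier hp.1 (by simp) (by simpa [h0] using hp.2)
  have h2 : segment ℝ 0 q ⊆ X.carrier :=
    segment_subset_carrier (by simp) hq.1 (by simpa [h0] using hq.2)
  exact ⟨_, (PLPath.single h1).trans (PLPath.single h2)⟩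

theorem le_idist {p q : EuclideanSpace ℝ (Fin M)} (hp : p ∈ X.carrier) (hq : q ∈ X.carrier) {c : ℝ}
    (h : ∀ l, PLPath X p q l → c ≤ l) : c ≤ X.idist p q := by
  rw [idist_eq]
  exact le_csInf (exists_plPath hp hq) h

theorem norm_sub_le_idist {p q : EuclideanSpace ℝ (Fin M)} (hp : p ∈ X.carrier)
    (hq : q ∈ X.carrier) : ‖q - p‖ ≤ X.idist p q :=
  le_idist hp hq fun _ h => h.norm_sub_le

theorem idist_comm (p q : EuclideanSpace ℝ (Fin M)) : X.idist p q = X.idist q p := by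
  simp only [idist_eq]
  congr 1
  ext l
  exact ⟨PLPath.symm, PLPath.symm⟩

theorem idist_triangle {p q r : EuclideanSpace ℝ (Fin M)} (hp : p ∈ X.carrier)
    (hq : q ∈ X.carrier) (hr : r ∈ X.carrier) :
    X.idist p r ≤ X.idist p q + X.idist q r := by
  rw [← sub_le_iff_le_add']
  refine le_idist hq hr fun l hl => ?_
  rw [sub_le_comm]
  refine le_idist hp hq fun l' hl' => ?_
  linarith [(hl'.trans hl).idist_le]

theorem idist_eq_norm_sub {p q : EuclideanSpace ℝ (Fin M)} (h : segment ℝ p q ⊆ X.carrier) :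
    X.idist p q = ‖q - p‖ :=
  le_antisymm (PLPath.single h).idist_le
    (norm_sub_le_idist (h (left_mem_segment ℝ p q)) (h (right_mem_segment ℝ p q)))

end OrthantSpace

/-! ### Calibrations: certifying and characterising geodesics. -/

namespace OrthantSpace

variable {M m : ℕ} {X : OrthantSpace M m}

/-- If `ζ` has norm at most `L` on every orthant, the functional `⟨ζ, ·⟩` grows at most by
`L * ‖r - q‖` along a segment of the space. -/
theorem sum_mul_sub_le {ζ : Fin M → ℝ} {L : ℝ} (hL : 0 ≤ L)
    (hζ : ∀ G ∈ X.strata, ∑ e ∈ G, ζ e ^ 2 ≤ L ^ 2) {q r : EuclideanSpace ℝ (Fin M)}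
    (h : segment ℝ q r ⊆ X.carrier) :
    ∑ e, ζ e * (r e - q e) ≤ L * ‖r - q‖ ∧
      (∑ e, ζ e * (r e - q e) = L * ‖r - q‖ → ∀ e, (0 < q e ∨ 0 < r e) →
        L * (r e - q e) = ‖r - q‖ * ζ e) := by
  have hq := (X.mem_carrier_iff.1 (h (left_mem_segment ℝ q r))).1
  have hr := (X.mem_carrier_iff.1 (h (right_mem_segment ℝ q r))).1
  have hG := hζ _ (union_posAxes_mem h)
  set G := posAxes q ∪ posAxes r with hGdef
  have hoff : ∀ e, e ∉ G → r e - q e = 0 := by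
    intro e he
    simp only [hGdef, Finset.mem_union, mem_posAxes, not_or, not_lt] at he
    rw [le_antisymm he.1 (hq e), le_antisymm he.2 (hr e), sub_zero]
  have h1 : ∑ e, ζ e * (r e - q e) = ∑ e ∈ G, ζ e * (r e - q e) := by
    refine (Finset.sum_subset (Finset.subset_univ G) fun e _ he => ?_).symm
    rw [hoff e he, mul_zero]
  have h2 : ‖r - q‖ ^ 2 = ∑ e ∈ G, (r e - q e) ^ 2 := by
    rw [EuclideanSpace.real_norm_sq_eq]
    refine (Finset.sum_subset (Finset.subset_univ G) fun e _ he => ?_).symm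
    simp [hoff e he]
  have hn := norm_nonneg (r - q)
  -- This is the defect in Cauchy–Schwarz. In the equality case it is at most zero, which forces `r
  -- - q` to be proportional to `ζ` on `G`.
  have hexp : ∑ e ∈ G, (L * (r e - q e) - ‖r - q‖ * ζ e) ^ 2 =
      L ^ 2 * ‖r - q‖ ^ 2 - 2 * L * ‖r - q‖ * ∑ e ∈ G, ζ e * (r e - q e) +
        ‖r - q‖ ^ 2 * ∑ e ∈ G, ζ e ^ 2 := by
    nth_rewrite 1 [h2]
    rw [Finset.mul_sum, Finset.mul_sum, Finset.mul_sum, ← Finset.sum_sub_distrib,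
      ← Finset.sum_add_distrib]
    exact Finset.sum_congr rfl fun e _ => by ring
  rw [h1]
  refine ⟨?_, fun heq e he => ?_⟩
  · refine (abs_le_of_sq_le_sq' ?_ (by positivity)).2
    refine (Finset.sum_mul_sq_le_sq_mul_sq G _ _).trans ?_
    rw [← h2, mul_pow]
    gcongr
  · rw [heq] at hexp
    have h3 : ∑ e ∈ G, (L * (r e - q e) - ‖r - q‖ * ζ e) ^ 2 ≤ 0 := by
      rw [hexp]
      nlinarith [mul_le_mul_of_nonneg_left hG (sq_nonneg ‖r - q‖)]
    have h4 := (Finset.sum_eq_zero_iff_of_nonneg fun e _ => sq_nonneg _).1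
      (le_antisymm h3 (Finset.sum_nonneg fun e _ => sq_nonneg _)) e
      (by simpa [hGdef, mem_posAxes] using he)
    linarith [pow_eq_zero_iff (two_ne_zero) |>.1 h4]

theorem PLPath.sum_mul_sub_le {ζ : Fin M → ℝ} {L : ℝ} (hL : 0 ≤ L)
    (hζ : ∀ G ∈ X.strata, ∑ e ∈ G, ζ e ^ 2 ≤ L ^ 2) {p q : EuclideanSpace ℝ (Fin M)} {l : ℝ}
    (h : PLPath X p q l) : ∑ e, ζ e * (q e - p e) ≤ L * l := by
  induction h with
  | refl => simp
  | @step q r l _ hs ih =>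
    have h1 := (OrthantSpace.sum_mul_sub_le hL hζ hs).1
    have h2 : ∑ e, ζ e * (r e - p e) = ∑ e, ζ e * (q e - p e) + ∑ e, ζ e * (r e - q e) := by
      rw [← Finset.sum_add_distrib]
      exact Finset.sum_congr rfl fun e _ => by ring
    rw [h2, mul_add]
    exact add_le_add ih h1

theorem PLPath.nonneg {p q : EuclideanSpace ℝ (Fin M)} {l : ℝ} (h : PLPath X p q l) : 0 ≤ l :=
  (norm_nonneg _).trans h.norm_sub_le

/-- A piecewise linear path along which `⟨ζ, ·⟩` grows at the maximal rate `L` is determined by its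
starting point (for the decreasing coordinates) and its end point (for the increasing ones). -/
theorem PLPath.eq_of_sum_mul_sub_eq {ζ : Fin M → ℝ} {L : ℝ} (hL : 0 < L)
    (hζ : ∀ G ∈ X.strata, ∑ e ∈ G, ζ e ^ 2 ≤ L ^ 2) {p q : EuclideanSpace ℝ (Fin M)} {l : ℝ}
    (hp : ∀ i, 0 ≤ p i) (h : PLPath X p q l) (heq : ∑ e, ζ e * (q e - p e) = L * l) (e : Fin M) :
    (ζ e ≤ 0 → q e = max 0 (p e + l / L * ζ e)) ∧
      (0 < ζ e → p e = max 0 (q e - l / L * ζ e)) := by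
  induction h with
  | refl => simp [hp e]
  | @step q r l hpl hs ih =>
    have h1 := OrthantSpace.sum_mul_sub_le hL.le hζ hs
    have h2 : ∑ e, ζ e * (r e - p e) = ∑ e, ζ e * (q e - p e) + ∑ e, ζ e * (r e - q e) := by
      rw [← Finset.sum_add_distrib]
      exact Finset.sum_congr rfl fun e _ => by ring
    have h3 := hpl.sum_mul_sub_le hL.le hζ
    have ih' := ih (by linarith [h1.1])
    have h4 := h1.2 (by linarith [h1.1]) e
    have hq := (X.mem_carrier_iff.1 (hs (left_mem_segment ℝ q r))).1 e
    have hr := (X.mem_carrier_iff.1 (hs (right_mem_segment ℝ q r))).1 e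
    have hd : 0 ≤ ‖r - q‖ / L := by positivity
    rw [add_div, add_mul]
    set d := ‖r - q‖ / L
    -- On the last segment a coordinate either moves with velocity `ζ e`, in time `d`, or is zero
    -- throughout.
    have hcase : (r e = q e + d * ζ e) ∨ (q e = 0 ∧ r e = 0) := by
      by_cases hpos : 0 < q e ∨ 0 < r e
      · left
        have := h4 hpos
        have hLd : ‖r - q‖ = L * d := by simp only [d]; field_simp
        rw [hLd, mul_assoc] at this
        linarith [mul_left_cancel₀ hL.ne' this]
      · right
        simp only [not_or, not_lt] at hpos
        exact ⟨le_antisymm hpos.1 hq, le_antisymm hpos.2 hr⟩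
    constructor
    · intro hz
      have hdz : d * ζ e ≤ 0 := mul_nonpos_of_nonneg_of_nonpos hd hz
      have hqe := ih'.1 hz
      rcases le_total 0 (p e + l / L * ζ e) with h0 | h0
      · rw [max_eq_right h0] at hqe
        rcases hcase with hc | hc
        · rw [max_eq_right] <;> linarith
        · rw [max_eq_left] <;> linarith
      · rw [max_eq_left h0] at hqe
        rw [max_eq_left (by linarith)]
        rcases hcase with hc | hc <;> linarith
    · intro hz
      have hdz : 0 ≤ d * ζ e := mul_nonneg hd hz.le
      have hpe := ih'.2 hz
      rcases hcase with hc | hc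
      · rw [hpe, hc]; congr 1; ring
      · have hl : 0 ≤ l / L * ζ e := mul_nonneg (div_nonneg hpl.nonneg hL.le) hz.le
        rw [hpe, hc.1, hc.2, max_eq_left (by linarith), max_eq_left (by linarith)]

/-- The path whose decreasing coordinates start at `p` with velocity `ζ` and are stopped at `0`, and
whose increasing coordinates arrive at `q` with velocity `ζ`. -/
def calPath (p q : EuclideanSpace ℝ (Fin M)) (ζ : Fin M → ℝ) (s : ℝ) : EuclideanSpace ℝ (Fin M) :=
  WithLp.toLp 2 fun e => max 0 ((if ζ e ≤ 0 then p e else q e - ζ e) + s * ζ e)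

theorem calPath_apply (p q : EuclideanSpace ℝ (Fin M)) (ζ : Fin M → ℝ) (s : ℝ) (e : Fin M) :
    calPath p q ζ s e = max 0 ((if ζ e ≤ 0 then p e else q e - ζ e) + s * ζ e) := rfl

theorem calPath_of_nonpos {p q : EuclideanSpace ℝ (Fin M)} {ζ : Fin M → ℝ} {e : Fin M}
    (h : ζ e ≤ 0) (s : ℝ) : calPath p q ζ s e = max 0 (p e + s * ζ e) := by
  rw [calPath_apply, if_pos h]

theorem calPath_of_pos {p q : EuclideanSpace ℝ (Fin M)} {ζ : Fin M → ℝ} {e : Fin M}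
    (h : 0 < ζ e) (s : ℝ) : calPath p q ζ s e = max 0 (q e - (1 - s) * ζ e) := by
  rw [calPath_apply, if_neg h.not_ge]
  congr 1; ring

variable (X) in
/-- `ζ` is the velocity vector of a calibrated path from `p` to `q` of length `L`. -/
structure IsCalibration (p q : EuclideanSpace ℝ (Fin M)) (ζ : Fin M → ℝ) (L : ℝ) : Prop where
  nonneg : 0 ≤ L
  right_eq : ∀ e, ζ e ≤ 0 → max 0 (p e + ζ e) = q e
  left_eq : ∀ e, 0 < ζ e → max 0 (q e - ζ e) = p e
  mem_carrier : ∀ s ∈ Set.Icc (0 : ℝ) 1, calPath p q ζ s ∈ X.carrier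
  sum_sq_le : ∀ G ∈ X.strata, ∑ e ∈ G, ζ e ^ 2 ≤ L ^ 2
  sum_mul_sub : ∑ e, ζ e * (q e - p e) = L ^ 2

/-- An affine function changes sign only at its zero `-c / z`. -/
theorem mul_nonneg_of_not_between {c z s t : ℝ} (hst : s ≤ t)
    (h : ¬ (s < -c / z ∧ -c / z < t)) : 0 ≤ (c + s * z) * (c + t * z) := by
  by_contra! hlt
  apply h
  rcases lt_trichotomy z 0 with hz | rfl | hz
  · rw [lt_div_iff_of_neg hz, div_lt_iff_of_neg hz]
    have : t * z ≤ s * z := mul_le_mul_of_nonpos_right hst hz.le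
    rcases mul_neg_iff.1 hlt with h1 | h1 <;> constructor <;> linarith
  -- For `z = 0` the default value of `-c / 0` plays no role: the product is `c ^ 2`.
  · nlinarith [sq_nonneg c]
  · rw [lt_div_iff₀ hz, div_lt_iff₀ hz]
    have : s * z ≤ t * z := mul_le_mul_of_nonneg_right hst hz.le
    rcases mul_neg_iff.1 hlt with h1 | h1 <;> constructor <;> linarith

namespace IsCalibration

variable {p q : EuclideanSpace ℝ (Fin M)} {ζ : Fin M → ℝ} {L : ℝ}

theorem calPath_zero (h : IsCalibration X p q ζ L) (hp : ∀ i, 0 ≤ p i) : calPath p q ζ 0 = p := by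
  ext e
  by_cases hz : ζ e ≤ 0
  · simp [calPath_of_nonpos hz, hp e]
  · rw [not_le] at hz
    simp [calPath_of_pos hz, h.left_eq e hz]

theorem calPath_one (h : IsCalibration X p q ζ L) (hq : ∀ i, 0 ≤ q i) : calPath p q ζ 1 = q := by
  ext e
  by_cases hz : ζ e ≤ 0
  · simp [calPath_of_nonpos hz, h.right_eq e hz]
  · rw [not_le] at hz
    simp [calPath_of_pos hz, hq e]

/-- Induction on the number of breakpoints `-c e / ζ e` strictly between `s` and `t`. Without
breakpoints no coordinate changes sign, so the path is one segment in a closed orthant, with speed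
the norm of `ζ` on that orthant. Otherwise the path is cut at a breakpoint, which is strictly inside
neither half. -/
theorem exists_plPath_of_card (h : IsCalibration X p q ζ L) (n : ℕ) : ∀ s t : ℝ, 0 ≤ s → s ≤ t →
    t ≤ 1 → (Finset.univ.filter fun e => s < -(if ζ e ≤ 0 then p e else q e - ζ e) / ζ e ∧
      -(if ζ e ≤ 0 then p e else q e - ζ e) / ζ e < t).card ≤ n →
    ∃ l, PLPath X (calPath p q ζ s) (calPath p q ζ t) l ∧ l ≤ L * (t - s) := by
  set c : Fin M → ℝ := fun e => if ζ e ≤ 0 then p e else q e - ζ e with hc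
  induction n with
  | zero =>
    intro s t h0 hst h1 hcard
    rw [Nat.le_zero, Finset.card_eq_zero, Finset.filter_eq_empty_iff] at hcard
    have hsign : ∀ e, 0 ≤ (c e + s * ζ e) * (c e + t * ζ e) := fun e =>
      mul_nonneg_of_not_between hst (hcard (Finset.mem_univ e))
    have hm := X.mem_carrier_iff.1
      (h.mem_carrier ((s + t) / 2) ⟨by linarith, by linarith⟩)
    -- The midpoint detects the axes in use: an affine coordinate of constant weak sign is positive
    -- there unless it is nonpositive at both ends.
    set G := posAxes (calPath p q ζ ((s + t) / 2)) with hG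
    have hin : ∀ e ∈ G, 0 ≤ c e + s * ζ e ∧ 0 ≤ c e + t * ζ e := by
      intro e he
      rw [hG, mem_posAxes, calPath_apply, lt_max_iff] at he
      have he' : 0 < c e + (s + t) / 2 * ζ e := by simpa using he
      rcases nonneg_and_nonneg_or_nonpos_and_nonpos_of_mul_nonneg (hsign e) with h2 | h2
      · exact h2
      · linarith [h2.1, h2.2]
    have hout : ∀ e ∉ G, calPath p q ζ s e = 0 ∧ calPath p q ζ t e = 0 := by
      intro e he
      rw [hG, mem_posAxes, calPath_apply, lt_max_iff] at he
      have he' : c e + (s + t) / 2 * ζ e ≤ 0 := by simpa using he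
      simp only [calPath_apply, max_eq_left_iff]
      change c e + s * ζ e ≤ 0 ∧ c e + t * ζ e ≤ 0
      rcases nonneg_and_nonneg_or_nonpos_and_nonpos_of_mul_nonneg (hsign e) with h2 | h2
      · constructor <;> linarith [h2.1, h2.2]
      · exact h2
    have hs' := (X.mem_carrier_iff.1 (h.mem_carrier s ⟨h0, hst.trans h1⟩)).1
    have ht' := (X.mem_carrier_iff.1 (h.mem_carrier t ⟨h0.trans hst, h1⟩)).1
    refine ⟨_, PLPath.single (segment_subset_carrier hs' ht'
      (X.closure_mem _ hm.2 _ fun e he => ?_)), ?_⟩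
    · by_contra hne
      simp [mem_posAxes, hout e hne] at he
    · refine (abs_le_of_sq_le_sq' ?_ (mul_nonneg h.nonneg (by linarith))).2
      rw [EuclideanSpace.real_norm_sq_eq, ← Finset.sum_subset (Finset.subset_univ G)
        fun e _ he => by simp [hout e he]]
      have : ∀ e ∈ G, ((calPath p q ζ t - calPath p q ζ s) e) ^ 2 = (t - s) ^ 2 * ζ e ^ 2 := by
        intro e he
        have h2 := hin e he
        have h3 : calPath p q ζ t e = c e + t * ζ e := max_eq_right h2.2
        have h4 : calPath p q ζ s e = c e + s * ζ e := max_eq_right h2.1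
        rw [PiLp.sub_apply, h3, h4]; ring
      rw [Finset.sum_congr rfl this, ← Finset.mul_sum, mul_pow, mul_comm (L ^ 2)]
      gcongr
      exact h.sum_sq_le _ hm.2
  | succ n ih =>
    intro s t h0 hst h1 hcard
    by_cases hn : (Finset.univ.filter fun e => s < -c e / ζ e ∧ -c e / ζ e < t).card ≤ n
    · exact ih s t h0 hst h1 hn
    · have hpos : 0 < (Finset.univ.filter fun e => s < -c e / ζ e ∧ -c e / ζ e < t).card := by
        omega
      obtain ⟨e, he⟩ := Finset.card_pos.1 hpos
      have he' := (Finset.mem_filter.1 he).2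
      have hlt : ∀ S : Finset (Fin M), S ⊆ (Finset.univ.filter fun e =>
          s < -c e / ζ e ∧ -c e / ζ e < t) → e ∉ S → S.card ≤ n := by
        intro S hS heS
        have := Finset.card_lt_card
          (Finset.ssubset_iff_subset_ne.2 ⟨hS, fun h' => heS (h' ▸ he)⟩)
        exact Nat.lt_succ_iff.1 (this.trans_le hcard)
      obtain ⟨l, hl, hl'⟩ := ih s (-c e / ζ e) h0 he'.1.le (by linarith) (hlt _ (fun f hf => by
        simp only [Finset.mem_filter, Finset.mem_univ, true_and] at hf ⊢
        exact ⟨hf.1, hf.2.trans he'.2⟩) (by simp [hc]))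
      obtain ⟨k, hk, hk'⟩ := ih (-c e / ζ e) t (by linarith) he'.2.le h1 (hlt _ (fun f hf => by
        simp only [Finset.mem_filter, Finset.mem_univ, true_and] at hf ⊢
        exact ⟨he'.1.trans hf.1, hf.2⟩) (by simp [hc]))
      exact ⟨_, hl.trans hk, by linarith⟩

theorem exists_plPath (h : IsCalibration X p q ζ L) {s t : ℝ} (h0 : 0 ≤ s) (hst : s ≤ t)
    (h1 : t ≤ 1) : ∃ l, PLPath X (calPath p q ζ s) (calPath p q ζ t) l ∧ l ≤ L * (t - s) :=
  h.exists_plPath_of_card _ s t h0 hst h1 le_rfl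

theorem idist_calPath_le (h : IsCalibration X p q ζ L) {s t : ℝ} (h0 : 0 ≤ s) (hst : s ≤ t)
    (h1 : t ≤ 1) : X.idist (calPath p q ζ s) (calPath p q ζ t) ≤ L * (t - s) := by
  obtain ⟨l, hl, hl'⟩ := h.exists_plPath h0 hst h1
  exact hl.idist_le.trans hl'

/-- The functional `⟨ζ, ·⟩` has to grow by `L ^ 2` and grows at rate at most `L` along any path, so
no path is shorter than `L`; the calibrated path attains this. -/
theorem idist_eq (h : IsCalibration X p q ζ L) (hp : p ∈ X.carrier) (hq : q ∈ X.carrier) :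
    X.idist p q = L := by
  apply le_antisymm
  · have := h.idist_calPath_le le_rfl zero_le_one le_rfl
    rwa [h.calPath_zero (X.mem_carrier_iff.1 hp).1, h.calPath_one (X.mem_carrier_iff.1 hq).1,
      sub_zero, mul_one] at this
  · refine le_idist hp hq fun l hl => ?_
    have h1 := hl.sum_mul_sub_le h.nonneg h.sum_sq_le
    rw [h.sum_mul_sub] at h1
    rcases h.nonneg.eq_or_lt with h0 | h0
    · rw [← h0]; exact hl.nonneg
    · rw [sq] at h1
      exact le_of_mul_le_mul_left h1 h0

/-- A shortcut between two intermediate points would shorten the whole path below `L`. -/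
theorem idist_calPath (h : IsCalibration X p q ζ L) (hp : p ∈ X.carrier) (hq : q ∈ X.carrier)
    {s t : ℝ} (h0 : 0 ≤ s) (hst : s ≤ t) (h1 : t ≤ 1) :
    X.idist (calPath p q ζ s) (calPath p q ζ t) = L * (t - s) := by
  refine le_antisymm (h.idist_calPath_le h0 hst h1) ?_
  have e1 := h.idist_calPath_le le_rfl h0 (hst.trans h1)
  have e2 := h.idist_calPath_le (h0.trans hst) h1 le_rfl
  rw [h.calPath_zero (X.mem_carrier_iff.1 hp).1] at e1
  rw [h.calPath_one (X.mem_carrier_iff.1 hq).1] at e2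
  have ms := h.mem_carrier s ⟨h0, hst.trans h1⟩
  have mt := h.mem_carrier t ⟨h0.trans hst, h1⟩
  have t1 := idist_triangle hp ms hq
  have t2 := idist_triangle ms mt hq
  rw [h.idist_eq hp hq] at t1
  linarith

theorem isGeodesicOn (h : IsCalibration X p q ζ L) (hp : p ∈ X.carrier) (hq : q ∈ X.carrier) :
    X.IsGeodesicOn (calPath p q ζ) 1 (X.idist p q) := by
  refine ⟨h.mem_carrier, fun s hs t ht => ?_⟩
  rw [h.idist_eq hp hq]
  rcases le_total s t with hst | hst
  · rw [h.idist_calPath hp hq hs.1 hst ht.2, abs_sub_comm, abs_of_nonneg (sub_nonneg.2 hst)]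
  · rw [idist_comm, h.idist_calPath hp hq ht.1 hst hs.2, abs_of_nonneg (sub_nonneg.2 hst)]

/-- The infimum defining the distance is attained. In `eq_calPath` this replaces the two halves of
an arbitrary metric geodesic by piecewise linear paths. -/
theorem plPath_idist (h : IsCalibration X p q ζ L) (hp : p ∈ X.carrier)
    (hq : q ∈ X.carrier) : PLPath X p q (X.idist p q) := by
  obtain ⟨l, hl, hl'⟩ := h.exists_plPath le_rfl zero_le_one le_rfl
  rw [h.calPath_zero (X.mem_carrier_iff.1 hp).1, h.calPath_one (X.mem_carrier_iff.1 hq).1] at hl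
  have := hl.idist_le
  rw [sub_zero, mul_one, ← h.idist_eq hp hq] at hl'
  rwa [le_antisymm this hl']

/-- Shortest piecewise linear paths from `p` to `γ s` and from `γ s` to `q` have total length `L`,
so both saturate the calibration. The first then fixes the coordinates of `γ s` with `ζ e ≤ 0`, the
second those with `ζ e > 0`. -/
theorem eq_calPath (hex : ∀ p ∈ X.carrier, ∀ q ∈ X.carrier, ∃ ζ L, IsCalibration X p q ζ L)
    (h : IsCalibration X p q ζ L) (hp : p ∈ X.carrier) (hq : q ∈ X.carrier)
    {γ : ℝ → EuclideanSpace ℝ (Fin M)} (hγ : X.IsGeodesicOn γ 1 (X.idist p q)) (h0 : γ 0 = p)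
    (h1 : γ 1 = q) {s : ℝ} (hs : s ∈ Set.Icc (0 : ℝ) 1) : γ s = calPath p q ζ s := by
  have hy := hγ.1 s hs
  have d1 := hγ.2 0 (by simp) s hs
  have d2 := hγ.2 s hs 1 (by simp)
  rw [h0, h.idist_eq hp hq, zero_sub, abs_neg, abs_of_nonneg hs.1] at d1
  rw [h1, h.idist_eq hp hq, abs_sub_comm, abs_of_nonneg (sub_nonneg.2 hs.2)] at d2
  obtain ⟨ζ₁, L₁, c1⟩ := hex p hp _ hy
  obtain ⟨ζ₂, L₂, c2⟩ := hex _ hy q hq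
  have p1 := c1.plPath_idist hp hy
  have p2 := c2.plPath_idist hy hq
  rw [d1] at p1
  rw [d2] at p2
  have hyn := (X.mem_carrier_iff.1 hy).1
  -- If `L = 0`, everything collapses to `p`; the rigidity statement needs `L > 0`.
  rcases h.nonneg.eq_or_lt with hL | hL
  · have e1 := p1.norm_sub_le
    have e2 := h.idist_calPath_le le_rfl hs.1 hs.2
    rw [h.calPath_zero (X.mem_carrier_iff.1 hp).1] at e2
    have e3 := (norm_sub_le_idist hp (h.mem_carrier s hs)).trans e2
    rw [← hL, zero_mul, norm_le_zero_iff, sub_eq_zero] at e1 e3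
    rw [e1, e3]
  · have u1 := p1.sum_mul_sub_le h.nonneg h.sum_sq_le
    have u2 := p2.sum_mul_sub_le h.nonneg h.sum_sq_le
    have u3 : ∑ e, ζ e * (γ s e - p e) + ∑ e, ζ e * (q e - γ s e) = L ^ 2 := by
      rw [← h.sum_mul_sub, ← Finset.sum_add_distrib]
      exact Finset.sum_congr rfl fun e _ => by ring
    have v1 := p1.eq_of_sum_mul_sub_eq hL h.sum_sq_le (X.mem_carrier_iff.1 hp).1
      (by linarith)
    have v2 := p2.eq_of_sum_mul_sub_eq hL h.sum_sq_le hyn (by linarith)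
    rw [mul_div_cancel_left₀ _ hL.ne'] at v1 v2
    ext e
    by_cases hz : ζ e ≤ 0
    · rw [calPath_of_nonpos hz, (v1 e).1 hz]
    · rw [not_le] at hz
      rw [calPath_of_pos hz, (v2 e).2 hz]

end IsCalibration

end OrthantSpace

/-! ### Parametric maximum-weight independent sets in bipartite graphs. -/

section Bipartite

variable {ι : Type*}

/-- Positive ratios `σ`, `τ` on the two sides `A`, `B` of a bipartite weighted graph `R`, monotone
along the edges, whose level sets have weights in the ratio given by the level, such that no level
set contains an independent pair that is heavier than its first side. -/
structure IsRatioSystem (R : ι → ι → Prop) (A B : Finset ι) (a b σ τ : ι → ℝ) : Prop where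
  left_pos : ∀ e ∈ A, 0 < σ e
  right_pos : ∀ f ∈ B, 0 < τ f
  mono : ∀ e ∈ A, ∀ f ∈ B, R e f → σ e ≤ τ f
  balanced : ∀ r, ∑ e ∈ A with σ e = r, a e = r * ∑ f ∈ B with τ f = r, b f
  extremal : ∀ r, ∀ C ⊆ A, (∀ e ∈ C, σ e = r) → ∀ D ⊆ B, (∀ f ∈ D, τ f = r) →
    (∀ e ∈ C, ∀ f ∈ D, ¬ R e f) → ∑ e ∈ C, a e + r * ∑ f ∈ D, b f ≤ ∑ e ∈ A with σ e = r, a e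

namespace IsRatioSystem

variable {R : ι → ι → Prop} {A B : Finset ι} {a b σ τ : ι → ℝ}

open Classical in
-- This is `balanced` summed over the levels satisfying `P`.
theorem sum_filter (h : IsRatioSystem R A B a b σ τ) (P : ℝ → Prop) :
    ∑ e ∈ A with P (σ e), a e = ∑ f ∈ B with P (τ f), τ f * b f := by
  set T := (A.image σ ∪ B.image τ).filter P with hT
  have h1 : ∀ e ∈ A.filter (fun e => P (σ e)), σ e ∈ T := by
    intro e he
    rw [Finset.mem_filter] at he
    exact Finset.mem_filter.2
      ⟨Finset.mem_union_left _ (Finset.mem_image_of_mem _ he.1), he.2⟩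
  have h2 : ∀ e ∈ B.filter (fun e => P (τ e)), τ e ∈ T := by
    intro e he
    rw [Finset.mem_filter] at he
    exact Finset.mem_filter.2
      ⟨Finset.mem_union_right _ (Finset.mem_image_of_mem _ he.1), he.2⟩
  rw [← Finset.sum_fiberwise_of_maps_to h1, ← Finset.sum_fiberwise_of_maps_to h2]
  refine Finset.sum_congr rfl fun r hr => ?_
  have hr' : P r := (Finset.mem_filter.1 hr).2
  have e1 : (A.filter fun e => P (σ e)).filter (fun e => σ e = r) =
      A.filter fun e => σ e = r := by
    ext e
    simp only [Finset.mem_filter]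
    constructor
    · exact fun h => ⟨h.1.1, h.2⟩
    · rintro ⟨h, rfl⟩; exact ⟨⟨h, hr'⟩, rfl⟩
  have e2 : (B.filter fun e => P (τ e)).filter (fun e => τ e = r) =
      B.filter fun e => τ e = r := by
    ext e
    simp only [Finset.mem_filter]
    constructor
    · exact fun h => ⟨h.1.1, h.2⟩
    · rintro ⟨h, rfl⟩; exact ⟨⟨h, hr'⟩, rfl⟩
  rw [e1, e2, h.balanced, Finset.mul_sum]
  exact Finset.sum_congr rfl fun f hf => by rw [(Finset.mem_filter.1 hf).2]

open Classical in
-- By `sum_filter` the left side of `hr` is the sum of `τ f * b f` over `r < τ f`, which exceeds the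
-- right side unless no such `f` exists; then the levels of `σ` above `r` carry no weight either.
theorem le_of_sum_le (h : IsRatioSystem R A B a b σ τ) (ha : ∀ e ∈ A, 0 < a e)
    (hb : ∀ f ∈ B, 0 < b f) {r : ℝ} (hr : ∑ e ∈ A with r < σ e, a e ≤ r * ∑ f ∈ B with r < τ f, b f) :
    (∀ e ∈ A, σ e ≤ r) ∧ ∀ f ∈ B, τ f ≤ r := by
  have hB : ∀ f ∈ B, τ f ≤ r := by
    by_contra! hne
    obtain ⟨f, hf, hlt⟩ := hne
    rw [h.sum_filter (fun x => r < x), Finset.mul_sum] at hr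
    refine absurd hr (not_le.2 (Finset.sum_lt_sum_of_nonempty
      ⟨f, Finset.mem_filter.2 ⟨hf, hlt⟩⟩ fun f hf => ?_))
    rw [Finset.mem_filter] at hf
    exact mul_lt_mul_of_pos_right hf.2 (hb f hf.1)
  refine ⟨?_, hB⟩
  by_contra! hne
  obtain ⟨e, he, hlt⟩ := hne
  rw [Finset.filter_false_of_mem (s := B) fun f hf => (hB f hf).not_gt, Finset.sum_empty,
    mul_zero] at hr
  exact absurd hr (not_le.2 (Finset.sum_pos (fun e he => ha e (Finset.mem_filter.1 he).1)
    ⟨e, Finset.mem_filter.2 ⟨he, hlt⟩⟩))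

open Classical in
theorem ge_of_le_sum (h : IsRatioSystem R A B a b σ τ) (ha : ∀ e ∈ A, 0 < a e)
    (hb : ∀ f ∈ B, 0 < b f) {r : ℝ} (hr : r * ∑ f ∈ B with τ f < r, b f ≤ ∑ e ∈ A with σ e < r, a e) :
    (∀ e ∈ A, r ≤ σ e) ∧ ∀ f ∈ B, r ≤ τ f := by
  have hB : ∀ f ∈ B, r ≤ τ f := by
    by_contra! hne
    obtain ⟨f, hf, hlt⟩ := hne
    rw [h.sum_filter (fun x => x < r), Finset.mul_sum] at hr
    refine absurd hr (not_le.2 (Finset.sum_lt_sum_of_nonempty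
      ⟨f, Finset.mem_filter.2 ⟨hf, hlt⟩⟩ fun f hf => ?_))
    rw [Finset.mem_filter] at hf
    exact mul_lt_mul_of_pos_right hf.2 (hb f hf.1)
  refine ⟨?_, hB⟩
  by_contra! hne
  obtain ⟨e, he, hlt⟩ := hne
  have h0 : ∑ e ∈ A with σ e < r, a e = 0 := by
    rw [h.sum_filter (fun x => x < r),
      Finset.filter_false_of_mem (s := B) fun f hf => (hB f hf).not_gt, Finset.sum_empty]
  exact h0.not_gt (Finset.sum_pos (fun e he => ha e (Finset.mem_filter.1 he).1)
    ⟨e, Finset.mem_filter.2 ⟨he, hlt⟩⟩)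

variable [DecidableEq ι]

/-- Ratio systems on `(A \ C, D)` and `(C, B \ D)` combine if the first lies below the second and
`(C, D)` is independent. -/
theorem combine {C D : Finset ι} {σ₁ τ₁ σ₂ τ₂ : ι → ℝ} {r : ℝ} (hC : C ⊆ A) (hD : D ⊆ B)
    (h₁ : IsRatioSystem R (A \ C) D a b σ₁ τ₁) (h₂ : IsRatioSystem R C (B \ D) a b σ₂ τ₂)
    (hind : ∀ e ∈ C, ∀ f ∈ D, ¬ R e f) (hσ : ∀ e ∈ A \ C, σ₁ e ≤ r) (hτ : ∀ f ∈ B \ D, r ≤ τ₂ f) :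
    IsRatioSystem R A B a b (fun e => if e ∈ C then σ₂ e else σ₁ e)
      (fun f => if f ∈ D then τ₁ f else τ₂ f) := by
  have hA : ∀ s, ∑ e ∈ A with (if e ∈ C then σ₂ e else σ₁ e) = s, a e =
      ∑ e ∈ A \ C with σ₁ e = s, a e + ∑ e ∈ C with σ₂ e = s, a e := by
    intro s
    rw [← Finset.sum_union (Finset.disjoint_filter_filter Finset.sdiff_disjoint)]
    refine Finset.sum_congr ?_ fun _ _ => rfl
    ext e
    have := @hC e
    by_cases he : e ∈ C
    · simp [he]; tauto
    · simp [he]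
  have hB : ∀ s, ∑ f ∈ B with (if f ∈ D then τ₁ f else τ₂ f) = s, b f =
      ∑ f ∈ D with τ₁ f = s, b f + ∑ f ∈ B \ D with τ₂ f = s, b f := by
    intro s
    rw [← Finset.sum_union (Finset.disjoint_filter_filter Finset.disjoint_sdiff)]
    refine Finset.sum_congr ?_ fun _ _ => rfl
    ext e
    have := @hD e
    by_cases he : e ∈ D
    · simp [he]; tauto
    · simp [he]
  refine ⟨fun e he => ?_, fun f hf => ?_, fun e he f hf hR => ?_, fun s => ?_, ?_⟩
  · split_ifs with h
    · exact h₂.left_pos e h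
    · exact h₁.left_pos e (Finset.mem_sdiff.2 ⟨he, h⟩)
  · split_ifs with h
    · exact h₁.right_pos f h
    · exact h₂.right_pos f (Finset.mem_sdiff.2 ⟨hf, h⟩)
  -- Edges from `C` to `D` are excluded, and those from `A \ C` to `B \ D` cross the threshold `r`.
  · split_ifs with h h' h'
    · exact absurd hR (hind e h f h')
    · exact h₂.mono e h f (Finset.mem_sdiff.2 ⟨hf, h'⟩) hR
    · exact h₁.mono e (Finset.mem_sdiff.2 ⟨he, h⟩) f h' hR
    · exact (hσ e (Finset.mem_sdiff.2 ⟨he, h⟩)).trans (hτ f (Finset.mem_sdiff.2 ⟨hf, h'⟩))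
  · rw [hA, hB, h₁.balanced, h₂.balanced]; ring
  · intro s C' hC' hσ' D' hD' hτ' hind'
    -- An independent pair splits along the two pieces, and the two extremality bounds add up.
    have e1 := h₁.extremal s (C' \ C) (Finset.sdiff_subset_sdiff hC' le_rfl)
      (fun e he => by
        rw [Finset.mem_sdiff] at he
        simpa [he.2] using hσ' e he.1) (D' ∩ D) Finset.inter_subset_right
      (fun f hf => by
        rw [Finset.mem_inter] at hf
        simpa [hf.2] using hτ' f hf.1)
      (fun e he f hf => hind' e (Finset.mem_sdiff.1 he).1 f (Finset.mem_inter.1 hf).1)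
    have e2 := h₂.extremal s (C' ∩ C) Finset.inter_subset_right
      (fun e he => by
        rw [Finset.mem_inter] at he
        simpa [he.2] using hσ' e he.1) (D' \ D) (Finset.sdiff_subset_sdiff hD' le_rfl)
      (fun f hf => by
        rw [Finset.mem_sdiff] at hf
        simpa [hf.2] using hτ' f hf.1)
      (fun e he f hf => hind' e (Finset.mem_inter.1 he).1 f (Finset.mem_sdiff.1 hf).1)
    rw [hA, ← Finset.sum_inter_add_sum_sdiff C' C, ← Finset.sum_inter_add_sum_sdiff D' D]
    linarith

end IsRatioSystem

/-- Parametric maximal independent sets: a bipartite weighted graph without isolated vertices has a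
ratio system. -/
theorem exists_isRatioSystem (R : ι → ι → Prop) (a b : ι → ℝ) (A B : Finset ι)
    (ha : ∀ e ∈ A, 0 < a e) (hb : ∀ f ∈ B, 0 < b f) (hA : ∀ e ∈ A, ∃ f ∈ B, R e f)
    (hB : ∀ f ∈ B, ∃ e ∈ A, R e f) : ∃ σ τ : ι → ℝ, IsRatioSystem R A B a b σ τ := by
  classical
  induction hn : A.card + B.card using Nat.strong_induction_on generalizing A B with
  | _ n ih =>
  rcases A.eq_empty_or_nonempty with rfl | hAne
  · have hB0 : B = ∅ := by
      refine Finset.eq_empty_of_forall_notMem fun f hf => ?_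
      obtain ⟨e, he, -⟩ := hB f hf
      simp at he
    subst hB0
    refine ⟨1, 1, ⟨by simp, by simp, by simp, by simp, ?_⟩⟩
    intro r C hC _ D hD _ _
    simp [Finset.subset_empty.1 hC, Finset.subset_empty.1 hD]
  have hBne : B.Nonempty := by
    obtain ⟨e, he⟩ := hAne
    obtain ⟨f, hf, -⟩ := hA e he
    exact ⟨f, hf⟩
  have hSA := Finset.sum_pos ha hAne
  have hSB := Finset.sum_pos hb hBne
  -- The only possible ratio if there is a single level.
  obtain ⟨r, hr, hr0⟩ : ∃ r, ∑ e ∈ A, a e = r * ∑ f ∈ B, b f ∧ 0 < r :=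
    ⟨(∑ e ∈ A, a e) / ∑ f ∈ B, b f, by field_simp, by positivity⟩
  by_cases hext : ∀ C ⊆ A, ∀ D ⊆ B, (∀ e ∈ C, ∀ f ∈ D, ¬ R e f) →
      ∑ e ∈ C, a e + r * ∑ f ∈ D, b f ≤ ∑ e ∈ A, a e
  · refine ⟨fun _ => r, fun _ => r, fun _ _ => hr0, fun _ _ => hr0, fun _ _ _ _ _ => le_rfl, ?_, ?_⟩
    · intro s
      by_cases hs : r = s
      · subst hs; simpa using hr
      · simp [hs]
    · intro s C hC hCs D hD hDs hind
      by_cases hs : r = s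
      · subst hs
        simpa using hext C hC D hD hind
      · rw [Finset.eq_empty_of_forall_notMem fun e he => hs (hCs e he),
          Finset.eq_empty_of_forall_notMem fun e he => hs (hDs e he)]
        simp [hs]
  push Not at hext
  obtain ⟨C₀, hC₀, D₀, hD₀, hind₀, hlt₀⟩ := hext
  -- Otherwise some independent pair outweighs `A`, and a heaviest one is taken. It has both sides
  -- nonempty, since either side alone weighs at most `∑ a = r * ∑ b`. Hence `(A \ C, D)` and `(C, B
  -- \ D)` are both smaller problems.
  obtain ⟨⟨C, D⟩, hmem, hmax⟩ := Finset.exists_max_image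
    ((A.powerset ×ˢ B.powerset).filter fun p => ∀ e ∈ p.1, ∀ f ∈ p.2, ¬ R e f)
    (fun p => ∑ e ∈ p.1, a e + r * ∑ f ∈ p.2, b f)
    ⟨(C₀, D₀), by simpa [hC₀, hD₀] using hind₀⟩
  simp only [Finset.mem_filter, Finset.mem_product, Finset.mem_powerset] at hmem
  obtain ⟨⟨hC, hD⟩, hind⟩ := hmem
  have hmax' : ∀ C' ⊆ A, ∀ D' ⊆ B, (∀ e ∈ C', ∀ f ∈ D', ¬ R e f) →
      ∑ e ∈ C', a e + r * ∑ f ∈ D', b f ≤ ∑ e ∈ C, a e + r * ∑ f ∈ D, b f := by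
    intro C' hC' D' hD' hind'
    exact hmax (C', D') (by simpa [hC', hD'] using hind')
  have hlt : ∑ e ∈ A, a e < ∑ e ∈ C, a e + r * ∑ f ∈ D, b f :=
    hlt₀.trans_le (hmax' C₀ hC₀ D₀ hD₀ hind₀)
  have hDne : D.Nonempty := by
    rw [Finset.nonempty_iff_ne_empty]
    rintro rfl
    simp only [Finset.sum_empty, mul_zero, add_zero] at hlt
    exact hlt.not_ge (Finset.sum_le_sum_of_subset_of_nonneg hC fun e he _ => (ha e he).le)
  have hCne : C.Nonempty := by
    rw [Finset.nonempty_iff_ne_empty]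
    rintro rfl
    rw [hr, Finset.sum_empty, zero_add] at hlt
    exact hlt.not_ge (mul_le_mul_of_nonneg_left
      (Finset.sum_le_sum_of_subset_of_nonneg hD fun e he _ => (hb e he).le) hr0.le)
  have cA := Finset.card_sdiff_add_card_eq_card hC
  have cB := Finset.card_sdiff_add_card_eq_card hD
  have hCc := hCne.card_pos
  have hDc := hDne.card_pos
  obtain ⟨σ₁, τ₁, h₁⟩ := ih ((A \ C).card + D.card) (by omega) (A \ C) D
    (fun e he => ha e (Finset.mem_sdiff.1 he).1) (fun f hf => hb f (hD hf))
    (by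
      intro e he
      rw [Finset.mem_sdiff] at he
      by_contra! hno
      -- A vertex of `A \ C` without neighbour in `D` could be added to `C`, against maximality: no
      -- isolated vertex appears.
      have := hmax' (insert e C) (Finset.insert_subset he.1 hC) D hD (by
        intro e' he' f hf
        rcases Finset.mem_insert.1 he' with rfl | he'
        · exact hno f hf
        · exact hind e' he' f hf)
      rw [Finset.sum_insert he.2] at this
      linarith [ha e he.1])
    (by
      intro f hf
      obtain ⟨e, he, hR⟩ := hB f (hD hf)
      exact ⟨e, Finset.mem_sdiff.2 ⟨he, fun heC => hind e heC f hf hR⟩, hR⟩) rfl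
  obtain ⟨σ₂, τ₂, h₂⟩ := ih (C.card + (B \ D).card) (by omega) C (B \ D)
    (fun e he => ha e (hC he)) (fun f hf => hb f (Finset.mem_sdiff.1 hf).1)
    (by
      intro e he
      obtain ⟨f, hf, hR⟩ := hA e (hC he)
      exact ⟨f, Finset.mem_sdiff.2 ⟨hf, fun hfD => hind e he f hfD hR⟩, hR⟩)
    (by
      intro f hf
      rw [Finset.mem_sdiff] at hf
      by_contra! hno
      have := hmax' C hC (insert f D) (Finset.insert_subset hf.1 hD) (by
        intro e he f' hf'
        rcases Finset.mem_insert.1 hf' with rfl | hf'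
        · exact hno e he
        · exact hind e he f' hf')
      rw [Finset.sum_insert hf.2] at this
      have := mul_pos hr0 (hb f hf.1)
      linarith) rfl
  refine ⟨_, _, h₁.combine (r := r) hC hD h₂ hind ?_ ?_⟩
  · refine (h₁.le_of_sum_le (fun e he => ha e (Finset.mem_sdiff.1 he).1)
      (fun f hf => hb f (hD hf)) ?_).1
    have hdis : Disjoint C ((A \ C).filter fun e => r < σ₁ e) :=
      Finset.disjoint_of_subset_right (Finset.filter_subset _ _) Finset.disjoint_sdiff
    -- Moving the levels above `r` into `C` and out of `D` keeps the pair independent, by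
    -- monotonicity along edges. Maximality of `(C, D)` then shows that these levels are empty. The
    -- upper piece is treated symmetrically.
    have := hmax' (C ∪ (A \ C).filter fun e => r < σ₁ e)
      (Finset.union_subset hC ((Finset.filter_subset _ _).trans Finset.sdiff_subset))
      (D.filter fun f => ¬ r < τ₁ f) ((Finset.filter_subset _ _).trans hD) (by
        intro e he f hf hR
        rw [Finset.mem_filter] at hf
        rcases Finset.mem_union.1 he with he | he
        · exact hind e he f hf.1 hR
        · rw [Finset.mem_filter] at he
          exact hf.2 (he.2.trans_le (h₁.mono e he.1 f hf.1 hR)))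
    rw [Finset.sum_union hdis, ← Finset.sum_filter_add_sum_filter_not D (fun f => r < τ₁ f)] at this
    linarith
  · refine (h₂.ge_of_le_sum (fun e he => ha e (hC he))
      (fun f hf => hb f (Finset.mem_sdiff.1 hf).1) ?_).2
    have hdis : Disjoint D ((B \ D).filter fun f => τ₂ f < r) :=
      Finset.disjoint_of_subset_right (Finset.filter_subset _ _) Finset.disjoint_sdiff
    have := hmax' (C.filter fun e => ¬ σ₂ e < r) ((Finset.filter_subset _ _).trans hC)
      (D ∪ (B \ D).filter fun f => τ₂ f < r)
      (Finset.union_subset hD ((Finset.filter_subset _ _).trans Finset.sdiff_subset)) (by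
        intro e he f hf hR
        rw [Finset.mem_filter] at he
        rcases Finset.mem_union.1 hf with hf | hf
        · exact hind e he.1 f hf hR
        · rw [Finset.mem_filter] at hf
          exact he.2 ((h₂.mono e he.1 f hf.1 hR).trans_lt hf.2))
    rw [Finset.sum_union hdis, ← Finset.sum_filter_add_sum_filter_not C (fun e => σ₂ e < r)] at this
    linarith

/-- A decomposition of the sides `SA`, `SB` of a bipartite weighted graph into consecutive blocks
with weakly increasing ratios of weights, without edges from later to earlier blocks, such that no
block contains an independent pair that is relatively heavier than the block. -/
structure IsBlockSystem (R : ι → ι → Prop) (SA SB : Finset ι) (a b : ι → ℝ) {k : ℕ}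
    (A B : Fin k → Finset ι) : Prop where
  left_nonempty : ∀ i, (A i).Nonempty
  right_nonempty : ∀ i, (B i).Nonempty
  left_cover : ∀ e, e ∈ SA ↔ ∃ i, e ∈ A i
  right_cover : ∀ f, f ∈ SB ↔ ∃ i, f ∈ B i
  left_disj : ∀ i j e, e ∈ A i → e ∈ A j → i = j
  right_disj : ∀ i j f, f ∈ B i → f ∈ B j → i = j
  indep : ∀ i j, i < j → ∀ e ∈ A j, ∀ f ∈ B i, ¬ R e f
  mono : ∀ i j, i < j → (∑ e ∈ A i, a e) * ∑ f ∈ B j, b f ≤ (∑ e ∈ A j, a e) * ∑ f ∈ B i, b f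
  extremal : ∀ i, ∀ C ⊆ A i, ∀ D ⊆ B i, (∀ e ∈ C, ∀ f ∈ D, ¬ R e f) →
    (∑ e ∈ C, a e) * ∑ f ∈ B i, b f + (∑ f ∈ D, b f) * ∑ e ∈ A i, a e ≤
      (∑ e ∈ A i, a e) * ∑ f ∈ B i, b f

/-- The ratios of weights of the blocks are strictly increasing. -/
def BlocksStrict (a b : ι → ℝ) {k : ℕ} (A B : Fin k → Finset ι) : Prop :=
  ∀ i j, i < j → (∑ e ∈ A i, a e) * ∑ f ∈ B j, b f < (∑ e ∈ A j, a e) * ∑ f ∈ B i, b f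

/-- The blocks are the level sets of a ratio system in increasing order of level. By `balanced` the
ratio of weights of a block is its level, hence strictness. The bound on `k` later leaves finitely
many candidates. -/
theorem exists_isBlockSystem (R : ι → ι → Prop) (a b : ι → ℝ) (SA SB : Finset ι)
    (ha : ∀ e ∈ SA, 0 < a e) (hb : ∀ f ∈ SB, 0 < b f) (hA : ∀ e ∈ SA, ∃ f ∈ SB, R e f)
    (hB : ∀ f ∈ SB, ∃ e ∈ SA, R e f) : ∃ (k : ℕ) (A B : Fin k → Finset ι), k ≤ SA.card ∧
      IsBlockSystem R SA SB a b A B ∧ BlocksStrict a b A B := by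
  obtain ⟨σ, τ, h⟩ := exists_isRatioSystem R a b SA SB ha hb hA hB
  set T := SA.image σ with hT
  set r := T.orderEmbOfFin rfl with hr
  have hrpos : ∀ i, 0 < r i := by
    intro i
    obtain ⟨e, he, hei⟩ := Finset.mem_image.1 (T.orderEmbOfFin_mem rfl i)
    rw [hr, ← hei]
    exact h.left_pos e he
  have hrange : ∀ x ∈ T, ∃ i, r i = x := by
    intro x hx
    have : x ∈ Set.range r := by rw [hr, Finset.range_orderEmbOfFin]; exact hx
    exact this
  -- A level attained only by `τ` would have positive weight on the right and none on the left,
  -- against `balanced`.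
  have hτ : ∀ f ∈ SB, τ f ∈ T := by
    intro f hf
    by_contra hne
    have h1 := h.balanced (τ f)
    rw [Finset.filter_false_of_mem (s := SA) fun e he heq =>
      hne (Finset.mem_image.2 ⟨e, he, heq⟩), Finset.sum_empty] at h1
    have h2 : 0 < ∑ f' ∈ SB with τ f' = τ f, b f' :=
      Finset.sum_pos (fun f' hf' => hb f' (Finset.mem_filter.1 hf').1)
        ⟨f, Finset.mem_filter.2 ⟨hf, rfl⟩⟩
    exact absurd h1 (mul_pos (h.right_pos f hf) h2).ne
  have hAne : ∀ i, (SA.filter fun e => σ e = r i).Nonempty := by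
    intro i
    obtain ⟨e, he, hei⟩ := Finset.mem_image.1 (T.orderEmbOfFin_mem rfl i)
    exact ⟨e, Finset.mem_filter.2 ⟨he, hei⟩⟩
  have hApos : ∀ i, 0 < ∑ e ∈ SA with σ e = r i, a e := fun i =>
    Finset.sum_pos (fun e he => ha e (Finset.mem_filter.1 he).1) (hAne i)
  have hBpos : ∀ i, 0 < ∑ f ∈ SB with τ f = r i, b f := by
    intro i
    have := hApos i
    rw [h.balanced] at this
    exact pos_of_mul_pos_right this (hrpos i).le
  have hstrict : BlocksStrict a b (fun i => SA.filter fun e => σ e = r i)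
      (fun i => SB.filter fun f => τ f = r i) := by
    intro i j hij
    dsimp only
    rw [h.balanced, h.balanced, mul_assoc, mul_assoc,
      mul_comm (∑ f ∈ SB with τ f = r i, b f)]
    exact mul_lt_mul_of_pos_right (r.strictMono hij) (mul_pos (hBpos j) (hBpos i))
  refine ⟨T.card, fun i => SA.filter fun e => σ e = r i, fun i => SB.filter fun f => τ f = r i,
    Finset.card_image_le, ⟨hAne, fun i => ?_, fun e => ?_, fun f => ?_, fun i j e hi hj => ?_,
    fun i j f hi hj => ?_, fun i j hij e he f hf hR => ?_, fun i j hij => (hstrict i j hij).le, ?_⟩,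
    hstrict⟩
  · exact Finset.nonempty_of_sum_ne_zero (hBpos i).ne'
  · simp only [Finset.mem_filter]
    constructor
    · intro he
      obtain ⟨i, hi⟩ := hrange (σ e) (Finset.mem_image_of_mem _ he)
      exact ⟨i, he, hi.symm⟩
    · rintro ⟨i, he, -⟩; exact he
  · simp only [Finset.mem_filter]
    constructor
    · intro hf
      obtain ⟨i, hi⟩ := hrange (τ f) (hτ f hf)
      exact ⟨i, hf, hi.symm⟩
    · rintro ⟨i, hf, -⟩; exact hf
  · exact r.injective ((Finset.mem_filter.1 hi).2.symm.trans (Finset.mem_filter.1 hj).2)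
  · exact r.injective ((Finset.mem_filter.1 hi).2.symm.trans (Finset.mem_filter.1 hj).2)
  · rw [Finset.mem_filter] at he hf
    have := h.mono e he.1 f hf.1 hR
    rw [he.2, hf.2] at this
    exact (r.strictMono hij).not_ge this
  · intro i C hC D hD hind
    have h1 := h.extremal (r i) C (hC.trans (Finset.filter_subset _ _))
      (fun e he => (Finset.mem_filter.1 (hC he)).2) D (hD.trans (Finset.filter_subset _ _))
      (fun f hf => (Finset.mem_filter.1 (hD hf)).2) hind
    have h2 := mul_le_mul_of_nonneg_right h1 (hBpos i).le
    rw [add_mul] at h2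
    have h3 : r i * (∑ f ∈ D, b f) * (∑ f ∈ SB with τ f = r i, b f) =
        (∑ f ∈ D, b f) * ∑ e ∈ SA with σ e = r i, a e := by
      rw [h.balanced]; ring
    rwa [h3] at h2

end Bipartite

/-! ### Blocks of axes for a pair of points and the calibration they define. -/

theorem coordProj_apply {M : ℕ} (A : Finset (Fin M)) (x : EuclideanSpace ℝ (Fin M)) (e : Fin M) :
    coordProj A x e = if e ∈ A then x e else 0 := rfl

theorem norm_coordProj_sq {M : ℕ} (A : Finset (Fin M)) (x : EuclideanSpace ℝ (Fin M)) :
    ‖coordProj A x‖ ^ 2 = ∑ e ∈ A, x e ^ 2 := by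
  rw [EuclideanSpace.real_norm_sq_eq]
  simp [coordProj_apply, ite_pow]

namespace OrthantSpace

variable {M m : ℕ} {X : OrthantSpace M m}

theorem mem_commonAxes {p q : EuclideanSpace ℝ (Fin M)} {e : Fin M} :
    e ∈ X.commonAxes p q ↔ (0 < p e ∧ 0 < q e) ∨ (0 < p e ∧ insert e (posAxes q) ∈ X.strata) ∨
      (0 < q e ∧ insert e (posAxes p) ∈ X.strata) := by
  simp [commonAxes, mem_posAxes]

theorem commonAxes_comm (p q : EuclideanSpace ℝ (Fin M)) :
    X.commonAxes p q = X.commonAxes q p := by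
  ext e
  rw [mem_commonAxes, mem_commonAxes]
  tauto

theorem pair_mem_of_subset {G : Finset (Fin M)} (hG : G ∈ X.strata) {e f : Fin M} (he : e ∈ G)
    (hf : f ∈ G) : {e, f} ∈ X.strata :=
  X.closure_mem G hG _ (by simp [Finset.insert_subset_iff, he, hf])

theorem pair_mem_of_common {p q : EuclideanSpace ℝ (Fin M)} (hp : posAxes p ∈ X.strata)
    {e f : Fin M} (he : e ∈ X.commonAxes p q) (hf : 0 < p f) : {e, f} ∈ X.strata := by
  rw [mem_commonAxes] at he
  rcases he with he | he | he
  · exact pair_mem_of_subset hp (mem_posAxes.2 he.1) (mem_posAxes.2 hf)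
  · exact pair_mem_of_subset hp (mem_posAxes.2 he.1) (mem_posAxes.2 hf)
  · exact pair_mem_of_subset he.2 (by simp) (by simp [mem_posAxes, hf])

/-- The flag condition in terms of pairs; the case `e = f` covers the singletons. -/
theorem mem_strata_of_pairs (X : OrthantSpace M m) (hne : ∅ ∈ X.strata) {G : Finset (Fin M)}
    (h : ∀ e ∈ G, ∀ f ∈ G, {e, f} ∈ X.strata) : G ∈ X.strata := by
  refine X.flag G fun H hH hc => ?_
  interval_cases hcard : H.card
  · rwa [Finset.card_eq_zero.1 hcard]
  · obtain ⟨e, rfl⟩ := Finset.card_eq_one.1 hcard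
    simpa using h e (by simpa using hH) e (by simpa using hH)
  · obtain ⟨e, f, -, rfl⟩ := Finset.card_eq_two.1 hcard
    exact h e (hH (by simp)) f (hH (by simp))

/-- If `f` were compatible with all lost axes, it would be compatible with all of `E(p)`, since
common axes are compatible with every axis of `q`. By the flag condition `f` would then be common.
So the incompatibility graph has no isolated vertices. -/
theorem exists_incompatible {p q : EuclideanSpace ℝ (Fin M)} (hp : p ∈ X.carrier)
    (hq : q ∈ X.carrier) {f : Fin M} (hf : f ∈ posAxes q \ X.commonAxes p q) :
    ∃ e ∈ posAxes p \ X.commonAxes p q, {e, f} ∉ X.strata := by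
  rw [mem_carrier_iff] at hp hq
  rw [Finset.mem_sdiff] at hf
  by_contra! hno
  apply hf.2
  rw [mem_commonAxes]
  refine Or.inr (Or.inr ⟨mem_posAxes.1 hf.1, ?_⟩)
  have key : ∀ e ∈ posAxes p, {e, f} ∈ X.strata := by
    intro e he
    by_cases hc : e ∈ X.commonAxes p q
    · rw [commonAxes_comm] at hc
      exact pair_mem_of_common hq.2 hc (mem_posAxes.1 hf.1)
    · exact hno e (Finset.mem_sdiff.2 ⟨he, hc⟩)
  refine X.mem_strata_of_pairs (X.closure_mem _ hp.2 _ (Finset.empty_subset _))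
    fun e he e' he' => ?_
  rcases Finset.mem_insert.1 he with rfl | he <;> rcases Finset.mem_insert.1 he' with rfl | he'
  · exact pair_mem_of_subset hq.2 hf.1 hf.1
  · rw [Finset.pair_comm]; exact key _ he'
  · exact key e ‹_›
  · exact pair_mem_of_subset hp.2 he he'

variable (X) in
/-- The blocks of axes lost and gained along the geodesic from `p` to `q`. -/
def IsGeodesicBlocks (p q : EuclideanSpace ℝ (Fin M)) {k : ℕ} (A B : Fin k → Finset (Fin M)) :
    Prop :=
  IsBlockSystem (fun e f => {e, f} ∉ X.strata) (posAxes p \ X.commonAxes p q)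
    (posAxes q \ X.commonAxes p q) (fun e => p e ^ 2) (fun f => q f ^ 2) A B

theorem exists_isGeodesicBlocks {p q : EuclideanSpace ℝ (Fin M)} (hp : p ∈ X.carrier)
    (hq : q ∈ X.carrier) : ∃ (k : ℕ) (A B : Fin k → Finset (Fin M)), k ≤ M ∧
      X.IsGeodesicBlocks p q A B ∧ BlocksStrict (fun e => p e ^ 2) (fun f => q f ^ 2) A B := by
  obtain ⟨k, A, B, hk, h⟩ := exists_isBlockSystem (fun e f => {e, f} ∉ X.strata)
    (fun e => p e ^ 2) (fun f => q f ^ 2) (posAxes p \ X.commonAxes p q)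
    (posAxes q \ X.commonAxes p q)
    (fun e he => pow_pos (mem_posAxes.1 (Finset.mem_sdiff.1 he).1) 2)
    (fun f hf => pow_pos (mem_posAxes.1 (Finset.mem_sdiff.1 hf).1) 2)
    (fun e he => by
      rw [commonAxes_comm] at he ⊢
      obtain ⟨f, hf, hR⟩ := exists_incompatible hq hp he
      exact ⟨f, hf, by rwa [Finset.pair_comm]⟩)
    (fun f hf => exists_incompatible hp hq hf)
  exact ⟨k, A, B, hk.trans ((Finset.card_le_univ _).trans (by simp)), h⟩

/-- The time at which the geodesic with blocks `A`, `B` passes from block `i` of `A` to block `i`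
of `B`. -/
def blockTime (p q : EuclideanSpace ℝ (Fin M)) {k : ℕ} (A B : Fin k → Finset (Fin M))
    (i : Fin k) : ℝ :=
  ‖coordProj (A i) p‖ / (‖coordProj (A i) p‖ + ‖coordProj (B i) q‖)

open Classical in
variable (X) in
/-- The velocity vector of the geodesic with blocks `A`, `B`. -/
def blockVelocity (p q : EuclideanSpace ℝ (Fin M)) {k : ℕ} (A B : Fin k → Finset (Fin M))
    (e : Fin M) : ℝ :=
  if e ∈ X.commonAxes p q then q e - p e
  else if h : ∃ i, e ∈ A i then
    -((‖coordProj (A h.choose) p‖ + ‖coordProj (B h.choose) q‖) / ‖coordProj (A h.choose) p‖ * p e)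
  else if h : ∃ i, e ∈ B i then
    (‖coordProj (A h.choose) p‖ + ‖coordProj (B h.choose) q‖) / ‖coordProj (B h.choose) q‖ * q e
  else 0

namespace IsGeodesicBlocks

variable {p q : EuclideanSpace ℝ (Fin M)} {k : ℕ} {A B : Fin k → Finset (Fin M)}

theorem mem_left (h : X.IsGeodesicBlocks p q A B) {i : Fin k} {e : Fin M} (he : e ∈ A i) :
    0 < p e ∧ e ∉ X.commonAxes p q := by
  have := (h.left_cover e).2 ⟨i, he⟩
  rwa [Finset.mem_sdiff, mem_posAxes] at this

theorem mem_right (h : X.IsGeodesicBlocks p q A B) {i : Fin k} {e : Fin M} (he : e ∈ B i) :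
    0 < q e ∧ e ∉ X.commonAxes p q := by
  have := (h.right_cover e).2 ⟨i, he⟩
  rwa [Finset.mem_sdiff, mem_posAxes] at this

theorem not_pos_of_left (h : X.IsGeodesicBlocks p q A B) {i : Fin k} {e : Fin M} (he : e ∈ A i) :
    ¬ 0 < q e := fun hq =>
  (h.mem_left he).2 (mem_commonAxes.2 (Or.inl ⟨(h.mem_left he).1, hq⟩))

theorem not_pos_of_right (h : X.IsGeodesicBlocks p q A B) {i : Fin k} {e : Fin M} (he : e ∈ B i) :
    ¬ 0 < p e := fun hp =>
  (h.mem_right he).2 (mem_commonAxes.2 (Or.inl ⟨hp, (h.mem_right he).1⟩))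

theorem notMem_right (h : X.IsGeodesicBlocks p q A B) {i j : Fin k} {e : Fin M} (he : e ∈ A i) :
    e ∉ B j := fun hB => h.not_pos_of_left he (h.mem_right hB).1

theorem norm_left_pos (h : X.IsGeodesicBlocks p q A B) (i : Fin k) : 0 < ‖coordProj (A i) p‖ := by
  rw [norm_pos_iff]
  obtain ⟨e, he⟩ := h.left_nonempty i
  intro h0
  have := congrArg (fun v : EuclideanSpace ℝ (Fin M) => v e) h0
  simp only [coordProj_apply, if_pos he] at this
  exact (h.mem_left he).1.ne' this

theorem norm_right_pos (h : X.IsGeodesicBlocks p q A B) (i : Fin k) : 0 < ‖coordProj (B i) q‖ := by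
  rw [norm_pos_iff]
  obtain ⟨e, he⟩ := h.right_nonempty i
  intro h0
  have := congrArg (fun v : EuclideanSpace ℝ (Fin M) => v e) h0
  simp only [coordProj_apply, if_pos he] at this
  exact (h.mem_right he).1.ne' this

theorem blockTime_pos (h : X.IsGeodesicBlocks p q A B) (i : Fin k) : 0 < blockTime p q A B i :=
  div_pos (h.norm_left_pos i) (add_pos (h.norm_left_pos i) (h.norm_right_pos i))

theorem blockTime_lt_one (h : X.IsGeodesicBlocks p q A B) (i : Fin k) :
    blockTime p q A B i < 1 := by
  have h1 := h.norm_left_pos i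
  have h2 := h.norm_right_pos i
  rw [blockTime, div_lt_one (by positivity)]
  linarith

theorem blockTime_mono (h : X.IsGeodesicBlocks p q A B) {i j : Fin k} (hij : i < j) :
    blockTime p q A B i ≤ blockTime p q A B j := by
  have h1 := h.norm_left_pos i
  have h2 := h.norm_right_pos i
  have h3 := h.norm_left_pos j
  have h4 := h.norm_right_pos j
  have hm := h.mono i j hij
  simp only [← norm_coordProj_sq, ← mul_pow] at hm
  have := (pow_le_pow_iff_left₀ (by positivity) (by positivity) two_ne_zero).1 hm
  rw [blockTime, blockTime, div_le_div_iff₀ (by positivity) (by positivity)]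
  linarith

theorem blockTime_strictMono (h : X.IsGeodesicBlocks p q A B)
    (hs : BlocksStrict (fun e => p e ^ 2) (fun f => q f ^ 2) A B) :
    StrictMono (blockTime p q A B) := by
  intro i j hij
  have h1 := h.norm_left_pos i
  have h2 := h.norm_right_pos i
  have h3 := h.norm_left_pos j
  have h4 := h.norm_right_pos j
  have hm := hs i j hij
  simp only [← norm_coordProj_sq, ← mul_pow] at hm
  have := (pow_lt_pow_iff_left₀ (by positivity) (by positivity) two_ne_zero).1 hm
  rw [blockTime, blockTime, div_lt_div_iff₀ (by positivity) (by positivity)]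
  linarith

theorem blockVelocity_common {e : Fin M} (he : e ∈ X.commonAxes p q) :
    X.blockVelocity p q A B e = q e - p e := by
  rw [blockVelocity, if_pos he]

theorem blockVelocity_left (h : X.IsGeodesicBlocks p q A B) {i : Fin k} {e : Fin M}
    (he : e ∈ A i) : X.blockVelocity p q A B e =
      -((‖coordProj (A i) p‖ + ‖coordProj (B i) q‖) / ‖coordProj (A i) p‖ * p e) := by
  have hex : ∃ i, e ∈ A i := ⟨i, he⟩
  rw [blockVelocity, if_neg (h.mem_left he).2, dif_pos hex,
    h.left_disj _ _ e hex.choose_spec he]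

theorem blockVelocity_right (h : X.IsGeodesicBlocks p q A B) {i : Fin k} {e : Fin M}
    (he : e ∈ B i) : X.blockVelocity p q A B e =
      (‖coordProj (A i) p‖ + ‖coordProj (B i) q‖) / ‖coordProj (B i) q‖ * q e := by
  have hex : ∃ i, e ∈ B i := ⟨i, he⟩
  rw [blockVelocity, if_neg (h.mem_right he).2,
    dif_neg (fun ⟨j, hj⟩ => h.notMem_right hj he), dif_pos hex,
    h.right_disj _ _ e hex.choose_spec he]

theorem blockVelocity_left' (h : X.IsGeodesicBlocks p q A B) {i : Fin k} {e : Fin M}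
    (he : e ∈ A i) : X.blockVelocity p q A B e = -(p e / blockTime p q A B i) := by
  have h1 := h.norm_left_pos i
  have h2 := h.norm_right_pos i
  rw [h.blockVelocity_left he, blockTime]
  field_simp

theorem blockVelocity_right' (h : X.IsGeodesicBlocks p q A B) {i : Fin k} {e : Fin M}
    (he : e ∈ B i) : X.blockVelocity p q A B e = q e / (1 - blockTime p q A B i) := by
  have h1 := h.norm_left_pos i
  have h2 := h.norm_right_pos i
  have h3 : 1 - blockTime p q A B i =
      ‖coordProj (B i) q‖ / (‖coordProj (A i) p‖ + ‖coordProj (B i) q‖) := by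
    rw [blockTime]; field_simp; ring
  rw [h.blockVelocity_right he, h3]
  field_simp

/-- Every axis is common, lost, gained, or unused. -/
theorem cases (h : X.IsGeodesicBlocks p q A B) (hp : ∀ i, 0 ≤ p i) (hq : ∀ i, 0 ≤ q i)
    (e : Fin M) : e ∈ X.commonAxes p q ∨ (∃ i, e ∈ A i) ∨ (∃ i, e ∈ B i) ∨
      (e ∉ X.commonAxes p q ∧ (¬ ∃ i, e ∈ A i) ∧ (¬ ∃ i, e ∈ B i) ∧ p e = 0 ∧ q e = 0 ∧
        X.blockVelocity p q A B e = 0) := by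
  by_cases h0 : e ∈ X.commonAxes p q
  · exact Or.inl h0
  by_cases h1 : ∃ i, e ∈ A i
  · exact Or.inr (Or.inl h1)
  by_cases h2 : ∃ i, e ∈ B i
  · exact Or.inr (Or.inr (Or.inl h2))
  refine Or.inr (Or.inr (Or.inr ⟨h0, h1, h2, ?_, ?_, ?_⟩))
  · by_contra hne
    exact h1 ((h.left_cover e).1 (Finset.mem_sdiff.2
      ⟨mem_posAxes.2 (lt_of_le_of_ne (hp e) (Ne.symm hne)), h0⟩))
  · by_contra hne
    exact h2 ((h.right_cover e).1 (Finset.mem_sdiff.2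
      ⟨mem_posAxes.2 (lt_of_le_of_ne (hq e) (Ne.symm hne)), h0⟩))
  · rw [blockVelocity, if_neg h0, dif_neg h1, dif_neg h2]

theorem sum_eq (h : X.IsGeodesicBlocks p q A B) (hp : ∀ i, 0 ≤ p i) (hq : ∀ i, 0 ≤ q i)
    {f : Fin M → ℝ} (hf : ∀ e, X.blockVelocity p q A B e = 0 → f e = 0) :
    ∑ e, f e = ∑ e ∈ X.commonAxes p q, f e + ∑ i, (∑ e ∈ A i, f e + ∑ e ∈ B i, f e) := by
  rw [Finset.sum_add_distrib,
    ← Finset.sum_biUnion (s := Finset.univ) (t := A) (fun i _ j _ hij =>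
      Finset.disjoint_left.2 fun e he he' => hij (h.left_disj i j e he he')),
    ← Finset.sum_biUnion (s := Finset.univ) (t := B) (fun i _ j _ hij =>
      Finset.disjoint_left.2 fun e he he' => hij (h.right_disj i j e he he')),
    ← Finset.sum_union, ← Finset.sum_union]
  · refine (Finset.sum_subset (Finset.subset_univ _) fun e _ he => ?_).symm
    simp only [Finset.mem_union, Finset.mem_biUnion, Finset.mem_univ, true_and, not_or] at he
    rcases h.cases hp hq e with h' | h' | h' | h'
    · exact absurd h' he.1
    · exact absurd h' he.2.1
    · exact absurd h' he.2.2
    · exact hf e h'.2.2.2.2.2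
  · rw [Finset.disjoint_left]
    intro e he he'
    simp only [Finset.mem_union, Finset.mem_biUnion, Finset.mem_univ, true_and] at he'
    rcases he' with ⟨i, hi⟩ | ⟨i, hi⟩
    · exact (h.mem_left hi).2 he
    · exact (h.mem_right hi).2 he
  · rw [Finset.disjoint_left]
    intro e he he'
    simp only [Finset.mem_biUnion, Finset.mem_univ, true_and] at he he'
    obtain ⟨i, hi⟩ := he
    obtain ⟨j, hj⟩ := he'
    exact h.notMem_right hi hj

theorem calPath_common (hp : ∀ i, 0 ≤ p i) (hq : ∀ i, 0 ≤ q i) {e : Fin M}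
    (he : e ∈ X.commonAxes p q) {s : ℝ} (hs : s ∈ Set.Icc (0 : ℝ) 1) :
    calPath p q (X.blockVelocity p q A B) s e = (1 - s) * p e + s * q e := by
  have h0 : 0 ≤ (1 - s) * p e + s * q e :=
    add_nonneg (mul_nonneg (sub_nonneg.2 hs.2) (hp e)) (mul_nonneg hs.1 (hq e))
  by_cases hz : X.blockVelocity p q A B e ≤ 0
  · rw [calPath_of_nonpos hz, blockVelocity_common he,
      show p e + s * (q e - p e) = (1 - s) * p e + s * q e by ring, max_eq_right h0]
  · rw [not_le] at hz
    rw [calPath_of_pos hz, blockVelocity_common he,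
      show q e - (1 - s) * (q e - p e) = (1 - s) * p e + s * q e by ring, max_eq_right h0]

theorem calPath_left (h : X.IsGeodesicBlocks p q A B) {i : Fin k} {e : Fin M} (he : e ∈ A i)
    (s : ℝ) : calPath p q (X.blockVelocity p q A B) s e =
      max 0 (p e / blockTime p q A B i * (blockTime p q A B i - s)) := by
  have ht := h.blockTime_pos i
  have hp := (h.mem_left he).1
  have hv := h.blockVelocity_left' he
  have hz : X.blockVelocity p q A B e ≤ 0 := by
    rw [hv, neg_nonpos]; positivity
  rw [calPath_of_nonpos hz, hv]
  congr 1
  field_simp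
  ring

theorem calPath_right (h : X.IsGeodesicBlocks p q A B) {i : Fin k} {e : Fin M} (he : e ∈ B i)
    (s : ℝ) : calPath p q (X.blockVelocity p q A B) s e =
      max 0 (q e / (1 - blockTime p q A B i) * (s - blockTime p q A B i)) := by
  have ht : 0 < 1 - blockTime p q A B i := sub_pos.2 (h.blockTime_lt_one i)
  have hp := (h.mem_right he).1
  have hv := h.blockVelocity_right' he
  have hz : 0 < X.blockVelocity p q A B e := by
    rw [hv]; positivity
  rw [calPath_of_pos hz, hv]
  congr 1
  field_simp
  ring

theorem calPath_left_pos_iff (h : X.IsGeodesicBlocks p q A B) {i : Fin k} {e : Fin M}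
    (he : e ∈ A i) (s : ℝ) :
    0 < calPath p q (X.blockVelocity p q A B) s e ↔ s < blockTime p q A B i := by
  rw [h.calPath_left he, lt_max_iff,
    mul_pos_iff_of_pos_left (div_pos (h.mem_left he).1 (h.blockTime_pos i))]
  simp

theorem calPath_right_pos_iff (h : X.IsGeodesicBlocks p q A B) {i : Fin k} {e : Fin M}
    (he : e ∈ B i) (s : ℝ) :
    0 < calPath p q (X.blockVelocity p q A B) s e ↔ blockTime p q A B i < s := by
  rw [h.calPath_right he, lt_max_iff,
    mul_pos_iff_of_pos_left (div_pos (h.mem_right he).1 (sub_pos.2 (h.blockTime_lt_one i)))]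
  simp

theorem calPath_unused {e : Fin M} (hp : p e = 0) (hz : X.blockVelocity p q A B e = 0) (s : ℝ) :
    calPath p q (X.blockVelocity p q A B) s e = 0 := by
  rw [calPath_of_nonpos hz.le, hp, hz]
  simp

/-- By the flag condition only pairs matter, and the critical one is `e ∈ A i`, `f ∈ B j`. Both are
positive at time `s` only if `t_j < s < t_i`, so `j < i`, and `indep` says that such axes are
compatible. -/
theorem calPath_mem_carrier (h : X.IsGeodesicBlocks p q A B) (hp : p ∈ X.carrier)
    (hq : q ∈ X.carrier) (s : ℝ) :
    calPath p q (X.blockVelocity p q A B) s ∈ X.carrier := by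
  rw [mem_carrier_iff] at hp hq ⊢
  refine ⟨fun e => le_max_left _ _, X.mem_strata_of_pairs
    (X.closure_mem _ hp.2 _ (Finset.empty_subset _)) ?_⟩
  have hcq : ∀ {e f : Fin M}, e ∈ X.commonAxes p q → 0 < q f → {e, f} ∈ X.strata := by
    intro e f he hf
    rw [commonAxes_comm] at he
    exact pair_mem_of_common hq.2 he hf
  have hcp : ∀ {e f : Fin M}, e ∈ X.commonAxes p q → 0 < p f → {e, f} ∈ X.strata :=
    fun he hf => pair_mem_of_common hp.2 he hf
  have hall : ∀ {e f : Fin M}, e ∈ X.commonAxes p q →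
      0 < calPath p q (X.blockVelocity p q A B) s f → {e, f} ∈ X.strata := by
    intro e f he hf
    rcases h.cases hp.1 hq.1 f with hf' | ⟨i, hi⟩ | ⟨i, hi⟩ | hf'
    · rcases mem_commonAxes.1 hf' with h' | h' | h'
      · exact hcp he h'.1
      · exact hcp he h'.1
      · exact hcq he h'.1
    · exact hcp he (h.mem_left hi).1
    · exact hcq he (h.mem_right hi).1
    · exact absurd hf (calPath_unused hf'.2.2.2.1 hf'.2.2.2.2.2 s).not_gt
  have hmix : ∀ {e f : Fin M} {i j : Fin k}, e ∈ A i → f ∈ B j →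
      0 < calPath p q (X.blockVelocity p q A B) s e →
      0 < calPath p q (X.blockVelocity p q A B) s f → {e, f} ∈ X.strata := by
    intro e f i j hi hj he hf
    rw [h.calPath_left_pos_iff hi] at he
    rw [h.calPath_right_pos_iff hj] at hf
    by_contra hR
    rcases lt_trichotomy i j with hij | rfl | hij
    · exact (hf.trans he).not_ge (h.blockTime_mono hij)
    · exact lt_asymm he hf
    · exact h.indep j i hij e hi f hj hR
  intro e he f hf
  rw [mem_posAxes] at he hf
  rcases h.cases hp.1 hq.1 e with he' | ⟨i, hi⟩ | ⟨i, hi⟩ | he'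
  · exact hall he' hf
  · rcases h.cases hp.1 hq.1 f with hf' | ⟨j, hj⟩ | ⟨j, hj⟩ | hf'
    · rw [Finset.pair_comm]; exact hall hf' he
    · exact pair_mem_of_subset hp.2 (mem_posAxes.2 (h.mem_left hi).1)
        (mem_posAxes.2 (h.mem_left hj).1)
    · exact hmix hi hj he hf
    · exact absurd hf (calPath_unused hf'.2.2.2.1 hf'.2.2.2.2.2 s).not_gt
  · rcases h.cases hp.1 hq.1 f with hf' | ⟨j, hj⟩ | ⟨j, hj⟩ | hf'
    · rw [Finset.pair_comm]; exact hall hf' he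
    · rw [Finset.pair_comm]; exact hmix hj hi hf he
    · exact pair_mem_of_subset hq.2 (mem_posAxes.2 (h.mem_right hi).1)
        (mem_posAxes.2 (h.mem_right hj).1)
    · exact absurd hf (calPath_unused hf'.2.2.2.1 hf'.2.2.2.2.2 s).not_gt
  · exact absurd he (calPath_unused he'.2.2.2.1 he'.2.2.2.2.2 s).not_gt

/-- The bound on an orthant `O(G)` is proved block by block: the axes of `G` in `A i` and `B i` are
compatible, hence an independent pair, and `extremal` bounds their contribution by `(‖P_{A_i} p‖ +
‖P_{B_i} q‖) ^ 2`. -/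
theorem isCalibration (h : X.IsGeodesicBlocks p q A B) (hp : p ∈ X.carrier) (hq : q ∈ X.carrier) :
    X.IsCalibration p q (X.blockVelocity p q A B)
      (√(∑ e ∈ X.commonAxes p q, (q e - p e) ^ 2 +
        ∑ i, (‖coordProj (A i) p‖ + ‖coordProj (B i) q‖) ^ 2)) := by
  have hp' := (X.mem_carrier_iff.1 hp).1
  have hq' := (X.mem_carrier_iff.1 hq).1
  have hnn : 0 ≤ ∑ e ∈ X.commonAxes p q, (q e - p e) ^ 2 +
      ∑ i, (‖coordProj (A i) p‖ + ‖coordProj (B i) q‖) ^ 2 := by positivity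
  refine ⟨Real.sqrt_nonneg _, ?_, ?_, fun s _ => h.calPath_mem_carrier hp hq s, ?_, ?_⟩
  · intro e hz
    -- For `ζ e ≤ 0` the required identity is the value of the path at time `1`.
    have h1 : calPath p q (X.blockVelocity p q A B) 1 e = q e := by
      rcases h.cases hp' hq' e with he | ⟨i, he⟩ | ⟨i, he⟩ | he
      · rw [calPath_common hp' hq' he (by simp)]; ring
      · rw [le_antisymm (not_lt.1 (h.not_pos_of_left he)) (hq' e), h.calPath_left he,
          max_eq_left]
        exact mul_nonpos_of_nonneg_of_nonpos (div_nonneg (hp' e) (h.blockTime_pos i).le)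
          (sub_nonpos.2 (h.blockTime_lt_one i).le)
      · have h2 := sub_pos.2 (h.blockTime_lt_one i)
        rw [h.calPath_right he, div_mul_cancel₀ _ h2.ne', max_eq_right (hq' e)]
      · rw [calPath_unused he.2.2.2.1 he.2.2.2.2.2, he.2.2.2.2.1]
    rwa [calPath_of_nonpos hz, one_mul] at h1
  · intro e hz
    have h1 : calPath p q (X.blockVelocity p q A B) 0 e = p e := by
      rcases h.cases hp' hq' e with he | ⟨i, he⟩ | ⟨i, he⟩ | he
      · rw [calPath_common hp' hq' he (by simp)]; ring
      · have h2 := h.blockTime_pos i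
        rw [h.calPath_left he, sub_zero, div_mul_cancel₀ _ h2.ne', max_eq_right (hp' e)]
      · rw [le_antisymm (not_lt.1 (h.not_pos_of_right he)) (hp' e), h.calPath_right he,
          max_eq_left]
        exact mul_nonpos_of_nonneg_of_nonpos
          (div_nonneg (hq' e) (sub_nonneg.2 (h.blockTime_lt_one i).le))
          (by rw [zero_sub, neg_nonpos]; exact (h.blockTime_pos i).le)
      · rw [calPath_unused he.2.2.2.1 he.2.2.2.2.2, he.2.2.2.1]
    rwa [calPath_of_pos hz, sub_zero, one_mul] at h1
  · intro G hG
    rw [Real.sq_sqrt hnn]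
    have h1 : ∑ e ∈ G, X.blockVelocity p q A B e ^ 2 =
        ∑ e, if e ∈ G then X.blockVelocity p q A B e ^ 2 else 0 := by simp
    rw [h1, h.sum_eq hp' hq' (fun e he => by simp [he])]
    refine add_le_add (Finset.sum_le_sum fun e he => ?_) (Finset.sum_le_sum fun i _ => ?_)
    · rw [blockVelocity_common he]
      split_ifs
      · exact le_rfl
      · positivity
    · have a0 := h.norm_left_pos i
      have b0 := h.norm_right_pos i
      have hA : (∑ e ∈ A i, if e ∈ G then X.blockVelocity p q A B e ^ 2 else 0) =
          ((‖coordProj (A i) p‖ + ‖coordProj (B i) q‖) / ‖coordProj (A i) p‖) ^ 2 *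
            ∑ e ∈ A i with e ∈ G, p e ^ 2 := by
        rw [← Finset.sum_filter, Finset.mul_sum]
        refine Finset.sum_congr rfl fun e he => ?_
        rw [h.blockVelocity_left (Finset.mem_filter.1 he).1]; ring
      have hB : (∑ e ∈ B i, if e ∈ G then X.blockVelocity p q A B e ^ 2 else 0) =
          ((‖coordProj (A i) p‖ + ‖coordProj (B i) q‖) / ‖coordProj (B i) q‖) ^ 2 *
            ∑ e ∈ B i with e ∈ G, q e ^ 2 := by
        rw [← Finset.sum_filter, Finset.mul_sum]
        refine Finset.sum_congr rfl fun e he => ?_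
        rw [h.blockVelocity_right (Finset.mem_filter.1 he).1]; ring
      have hx := h.extremal i ((A i).filter (· ∈ G)) (Finset.filter_subset _ _)
        ((B i).filter (· ∈ G)) (Finset.filter_subset _ _) (fun e he f hf hR =>
          hR (pair_mem_of_subset hG (Finset.mem_filter.1 he).2 (Finset.mem_filter.1 hf).2))
      simp only [← norm_coordProj_sq (A i), ← norm_coordProj_sq (B i)] at hx
      rw [hA, hB]
      set α := ‖coordProj (A i) p‖
      set β := ‖coordProj (B i) q‖
      set c := ∑ e ∈ A i with e ∈ G, p e ^ 2
      set d := ∑ e ∈ B i with e ∈ G, q e ^ 2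
      have h2 : ((α + β) / α) ^ 2 * c + ((α + β) / β) ^ 2 * d =
          (α + β) ^ 2 * ((c * β ^ 2 + d * α ^ 2) / (α ^ 2 * β ^ 2)) := by
        field_simp
      rw [h2]
      have h3 : (c * β ^ 2 + d * α ^ 2) / (α ^ 2 * β ^ 2) ≤ 1 := by
        rw [div_le_one (by positivity)]; exact hx
      exact mul_le_of_le_one_right (by positivity) h3
  · rw [Real.sq_sqrt hnn, h.sum_eq hp' hq' (fun e he => by simp [he])]
    congr 1
    · refine Finset.sum_congr rfl fun e he => ?_
      rw [blockVelocity_common he]; ring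
    · refine Finset.sum_congr rfl fun i _ => ?_
      have a0 := h.norm_left_pos i
      have b0 := h.norm_right_pos i
      have hA : ∑ e ∈ A i, X.blockVelocity p q A B e * (q e - p e) =
          (‖coordProj (A i) p‖ + ‖coordProj (B i) q‖) / ‖coordProj (A i) p‖ *
            ‖coordProj (A i) p‖ ^ 2 := by
        rw [norm_coordProj_sq, Finset.mul_sum]
        refine Finset.sum_congr rfl fun e he => ?_
        rw [h.blockVelocity_left he, le_antisymm (not_lt.1 (h.not_pos_of_left he)) (hq' e)]; ring
      have hB : ∑ e ∈ B i, X.blockVelocity p q A B e * (q e - p e) =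
          (‖coordProj (A i) p‖ + ‖coordProj (B i) q‖) / ‖coordProj (B i) q‖ *
            ‖coordProj (B i) q‖ ^ 2 := by
        rw [norm_coordProj_sq, Finset.mul_sum]
        refine Finset.sum_congr rfl fun e he => ?_
        rw [h.blockVelocity_right he, le_antisymm (not_lt.1 (h.not_pos_of_right he)) (hp' e)]; ring
      rw [hA, hB]
      field_simp

end IsGeodesicBlocks

theorem exists_isCalibration (p : EuclideanSpace ℝ (Fin M)) (hp : p ∈ X.carrier)
    (q : EuclideanSpace ℝ (Fin M)) (hq : q ∈ X.carrier) : ∃ ζ L, X.IsCalibration p q ζ L := by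
  obtain ⟨k, A, B, -, h, -⟩ := exists_isGeodesicBlocks hp hq
  exact ⟨_, _, h.isCalibration hp hq⟩

end OrthantSpace

/-! ### The geodesic, its initial vector and its support. -/

namespace OrthantSpace

variable {M m : ℕ} {X : OrthantSpace M m}

/-- A strictly increasing sequence of times in `(0, 1)`, completed by `0` and `1`. -/
theorem exists_completed_times {k : ℕ} {t : Fin k → ℝ} (ht : StrictMono t) (h0 : ∀ i, 0 < t i)
    (h1 : ∀ i, t i < 1) : ∃ T : Fin (k + 2) → ℝ, StrictMono T ∧ T 0 = 0 ∧ T (Fin.last (k + 1)) = 1 ∧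
      ∀ i : Fin k, T i.succ.castSucc = t i := by
  refine ⟨Fin.cons 0 (Fin.snoc t 1 : Fin (k + 1) → ℝ), ?_, rfl, ?_, fun i => ?_⟩
  · intro a b hab
    induction b using Fin.cases with
    | zero => exact absurd hab (Fin.not_lt_zero a)
    | succ b =>
      rw [Fin.cons_succ]
      induction a using Fin.cases with
      | zero =>
        rw [Fin.cons_zero]
        induction b using Fin.lastCases with
        | last => simp
        | cast b => simpa using h0 b
      | succ a =>
        rw [Fin.cons_succ]
        rw [Fin.succ_lt_succ_iff] at hab
        induction a using Fin.lastCases with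
        | last => exact absurd hab (Fin.le_last b).not_gt
        | cast a =>
          induction b using Fin.lastCases with
          | last => simpa using h1 a
          | cast b => simpa using ht (Fin.castSucc_lt_castSucc_iff.1 hab)
  · rw [← Fin.succ_last, Fin.cons_succ, Fin.snoc_last]
  · rw [← Fin.succ_castSucc, Fin.cons_succ, Fin.snoc_castSucc]

theorem mem_stageAxes_cons {k : ℕ} {c : Finset (Fin M)} {A B : Fin k → Finset (Fin M)}
    {i : Fin (k + 1)} {e : Fin M} :
    e ∈ stageAxes (Fin.cons c A : Fin (k + 1) → Finset (Fin M)) (Fin.cons c B) i ↔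
      e ∈ c ∨ (∃ j : Fin k, j.succ ≤ i ∧ e ∈ B j) ∨ ∃ j : Fin k, i < j.succ ∧ e ∈ A j := by
  simp [stageAxes, Fin.exists_fin_succ, or_assoc]

namespace IsGeodesicBlocks

variable {p q : EuclideanSpace ℝ (Fin M)} {k : ℕ} {A B : Fin k → Finset (Fin M)}

/-- The calibrated path shows that the choice in `geodesic` meets its specification, and uniqueness
identifies what was chosen. -/
theorem geodesic_eq (h : X.IsGeodesicBlocks p q A B) (hp : p ∈ X.carrier) (hq : q ∈ X.carrier)
    {s : ℝ} (hs : s ∈ Set.Icc (0 : ℝ) 1) :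
    X.geodesic p q s = calPath p q (X.blockVelocity p q A B) s := by
  have hc := h.isCalibration hp hq
  have hspec := Classical.epsilon_spec
    (p := fun γ : ℝ → EuclideanSpace ℝ (Fin M) =>
      X.IsGeodesicOn γ 1 (X.idist p q) ∧ γ 0 = p ∧ γ 1 = q)
    ⟨_, hc.isGeodesicOn hp hq, hc.calPath_zero (X.mem_carrier_iff.1 hp).1,
      hc.calPath_one (X.mem_carrier_iff.1 hq).1⟩
  exact hc.eq_calPath exists_isCalibration hp hq hspec.1 hspec.2.1 hspec.2.2 hs

/-- Before the first block time the path is affine. The gained axes are still at rest at zero then,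
although `blockVelocity` is positive on them; this is the reason for the case distinction. -/
theorem log_eq (h : X.IsGeodesicBlocks p q A B) (hp : p ∈ X.carrier) (hq : q ∈ X.carrier) :
    X.log p q = WithLp.toLp 2 fun e =>
      if 0 < p e ∨ e ∈ X.commonAxes p q then X.blockVelocity p q A B e else 0 := by
  have hp' := (X.mem_carrier_iff.1 hp).1
  have hq' := (X.mem_carrier_iff.1 hq).1
  set v : EuclideanSpace ℝ (Fin M) := WithLp.toLp 2 fun e =>
    if 0 < p e ∨ e ∈ X.commonAxes p q then X.blockVelocity p q A B e else 0 with hv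
  have hve : ∀ e, v e = if 0 < p e ∨ e ∈ X.commonAxes p q then
    X.blockVelocity p q A B e else 0 := fun _ => rfl
  have hlt : ∀ᶠ s in 𝓝[Set.Icc 0 1] (0 : ℝ), ∀ i, s < blockTime p q A B i :=
    eventually_all.2 fun i => nhdsWithin_le_nhds (Iio_mem_nhds (h.blockTime_pos i))
  have hpath : X.geodesic p q =ᶠ[𝓝[Set.Icc 0 1] 0] fun s => p + s • v := by
    filter_upwards [hlt, self_mem_nhdsWithin] with s hs hs1
    rw [h.geodesic_eq hp hq hs1]
    ext e
    rw [PiLp.add_apply, PiLp.smul_apply, smul_eq_mul, hve]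
    rcases h.cases hp' hq' e with he | ⟨i, he⟩ | ⟨i, he⟩ | he
    · rw [if_pos (Or.inr he), blockVelocity_common he, calPath_common hp' hq' he hs1]; ring
    · have ht := h.blockTime_pos i
      rw [if_pos (Or.inl (h.mem_left he).1), h.blockVelocity_left' he, h.calPath_left he,
        max_eq_right (mul_nonneg (div_nonneg (hp' e) ht.le) (sub_nonneg.2 (hs i).le))]
      field_simp
      ring
    · have h0 := h.not_pos_of_right he
      rw [if_neg (by simpa [h0] using (h.mem_right he).2), mul_zero, add_zero,
        le_antisymm (not_lt.1 h0) (hp' e)]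
      refine le_antisymm (not_lt.1 fun hlt => ?_) (le_max_left _ _)
      exact lt_asymm (hs i) ((h.calPath_right_pos_iff he s).1 hlt)
    · rw [calPath_unused he.2.2.2.1 he.2.2.2.2.2, if_neg (by simp [he.1, he.2.2.2.1]), mul_zero,
        add_zero, he.2.2.2.1]
  have hd : HasDerivWithinAt (fun s : ℝ => p + s • v) v (Set.Icc 0 1) 0 := by
    simpa using ((hasDerivAt_id (0 : ℝ)).smul_const v).const_add p |>.hasDerivWithinAt
  have h0 : X.geodesic p q 0 = p + (0 : ℝ) • v := by
    rw [h.geodesic_eq hp hq (by simp), (h.isCalibration hp hq).calPath_zero hp', zero_smul, add_zero]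
  exact (hd.congr_of_eventuallyEq hpath h0).derivWithin
    (uniqueDiffOn_Icc zero_lt_one 0 (by simp))

/-- Adding `p` to the velocity gives `q e` on a common axis and `p e - (α + β) / α * p e = -(β / α)
* p e` on an axis of `A i`, where `α` and `β` are the norms of the blocks. -/
theorem translatedLog_eq (h : X.IsGeodesicBlocks p q A B) (hp : p ∈ X.carrier)
    (hq : q ∈ X.carrier) : X.translatedLog q p = coordProj (X.commonAxes p q) q -
      ∑ i, (‖coordProj (B i) q‖ / ‖coordProj (A i) p‖) • coordProj (A i) p := by
  have hp' := (X.mem_carrier_iff.1 hp).1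
  have hq' := (X.mem_carrier_iff.1 hq).1
  rw [translatedLog, h.log_eq hp hq]
  ext e
  simp only [PiLp.add_apply, PiLp.sub_apply, WithLp.ofLp_sum, Finset.sum_apply, PiLp.smul_apply,
    smul_eq_mul, coordProj_apply]
  have hsum : (¬ ∃ i, e ∈ A i) → ∑ i, ‖coordProj (B i) q‖ / ‖coordProj (A i) p‖ *
      (if e ∈ A i then p e else 0) = 0 := fun hA =>
    Finset.sum_eq_zero fun i _ => by rw [if_neg fun hi => hA ⟨i, hi⟩, mul_zero]
  rcases h.cases hp' hq' e with he | ⟨i, he⟩ | ⟨i, he⟩ | he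
  · rw [if_pos (Or.inr he), if_pos he, blockVelocity_common he,
      hsum fun ⟨i, hi⟩ => (h.mem_left hi).2 he]
    ring
  · rw [if_pos (Or.inl (h.mem_left he).1), if_neg (h.mem_left he).2, Finset.sum_eq_single i,
      if_pos he, h.blockVelocity_left he]
    · have h1 := h.norm_left_pos i
      field_simp
      ring
    · intro j _ hj
      rw [if_neg fun hi => hj (h.left_disj j i e hi he), mul_zero]
    · simp
  · have h0 := h.not_pos_of_right he
    rw [if_neg (by simpa [h0] using (h.mem_right he).2), if_neg (h.mem_right he).2,
      hsum fun ⟨j, hj⟩ => h0 (h.mem_left hj).1, le_antisymm (not_lt.1 h0) (hp' e)]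
    simp
  · rw [if_neg (by simp [he.1, he.2.2.2.1]), if_neg he.1, hsum he.2.1, he.2.2.2.1]
    simp

/-- Strict ratios make the block times strictly increasing, so each stage lasts for a positive time;
nonempty blocks make the stages distinct. -/
theorem isSupport (h : X.IsGeodesicBlocks p q A B)
    (hs : BlocksStrict (fun e => p e ^ 2) (fun f => q f ^ 2) A B) (hp : p ∈ X.carrier)
    (hq : q ∈ X.carrier) :
    X.IsSupport p q (Fin.cons (X.commonAxes p q) A : Fin (k + 1) → Finset (Fin M))
      (Fin.cons (X.commonAxes p q) B) := by
  have hp' := (X.mem_carrier_iff.1 hp).1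
  have hq' := (X.mem_carrier_iff.1 hq).1
  -- `Fin.cons` puts the common axes at index `0`, so block `i` carries the index `i.succ`.
  have hA : ∀ {i : Fin k} {e : Fin M} {j : Fin (k + 1)}, e ∈ A i →
      (e ∈ stageAxes (Fin.cons (X.commonAxes p q) A : Fin (k + 1) → Finset (Fin M))
        (Fin.cons (X.commonAxes p q) B) j ↔ j < i.succ) := by
    intro i e j he
    rw [mem_stageAxes_cons]
    constructor
    · rintro (h' | ⟨l, -, h'⟩ | ⟨l, hl, h'⟩)
      · exact absurd h' (h.mem_left he).2
      · exact absurd h' (h.notMem_right he)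
      · rwa [← h.left_disj l i e h' he]
    · exact fun h' => Or.inr (Or.inr ⟨i, h', he⟩)
  have hB : ∀ {i : Fin k} {e : Fin M} {j : Fin (k + 1)}, e ∈ B i →
      (e ∈ stageAxes (Fin.cons (X.commonAxes p q) A : Fin (k + 1) → Finset (Fin M))
        (Fin.cons (X.commonAxes p q) B) j ↔ i.succ ≤ j) := by
    intro i e j he
    rw [mem_stageAxes_cons]
    constructor
    · rintro (h' | ⟨l, hl, h'⟩ | ⟨l, -, h'⟩)
      · exact absurd h' (h.mem_right he).2
      · rwa [← h.right_disj l i e h' he]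
      · exact absurd he (h.notMem_right h')
    · exact fun h' => Or.inr (Or.inl ⟨i, h', he⟩)
  have hC : ∀ {e : Fin M} (j : Fin (k + 1)), e ∈ X.commonAxes p q →
      e ∈ stageAxes (Fin.cons (X.commonAxes p q) A : Fin (k + 1) → Finset (Fin M))
        (Fin.cons (X.commonAxes p q) B) j := fun j he => mem_stageAxes_cons.2 (Or.inl he)
  have hE : ∀ {e : Fin M} {j : Fin (k + 1)},
      e ∈ stageAxes (Fin.cons (X.commonAxes p q) A : Fin (k + 1) → Finset (Fin M))
        (Fin.cons (X.commonAxes p q) B) j →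
      e ∈ X.commonAxes p q ∨ (∃ i, e ∈ A i) ∨ ∃ i, e ∈ B i := by
    intro e j he
    rcases mem_stageAxes_cons.1 he with h' | ⟨i, -, h'⟩ | ⟨i, -, h'⟩
    · exact Or.inl h'
    · exact Or.inr (Or.inr ⟨i, h'⟩)
    · exact Or.inr (Or.inl ⟨i, h'⟩)
  refine ⟨rfl, rfl, ⟨?_, ?_⟩, fun i => ⟨?_, ?_⟩⟩
  · have hne : ∀ i j : Fin (k + 1), i < j →
        stageAxes (Fin.cons (X.commonAxes p q) A : Fin (k + 1) → Finset (Fin M))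
          (Fin.cons (X.commonAxes p q) B) i ≠ stageAxes (Fin.cons (X.commonAxes p q) A)
          (Fin.cons (X.commonAxes p q) B) j := by
      intro i j hij heq
      obtain ⟨l, rfl⟩ := Fin.exists_succ_eq.2 (Fin.ne_zero_of_lt hij)
      obtain ⟨e, he⟩ := h.left_nonempty l
      have h1 := (hA he).2 hij
      rw [heq] at h1
      exact lt_irrefl _ ((hA he).1 h1)
    intro i j heq
    rcases lt_trichotomy i j with hij | hij | hij
    · exact absurd heq (hne i j hij)
    · exact hij
    · exact absurd heq.symm (hne j i hij)
  · obtain ⟨T, hT, hT0, hT1, hTi⟩ := exists_completed_times (h.blockTime_strictMono hs)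
      h.blockTime_pos h.blockTime_lt_one
    refine ⟨T, hT, hT0, hT1, fun i s hsi => ?_⟩
    have hs0 : 0 < s := by
      rw [← hT0]; exact (hT.monotone (Fin.zero_le _)).trans_lt hsi.1
    have hs1 : s < 1 := by
      rw [← hT1]; exact hsi.2.trans_le (hT.monotone (Fin.le_last _))
    have hlt : ∀ j : Fin k, i < j.succ → s < blockTime p q A B j := by
      intro j hij
      rw [← hTi]
      refine hsi.2.trans_le (hT.monotone ?_)
      rw [Fin.le_def]
      rw [Fin.lt_def] at hij
      simpa using hij
    have hgt : ∀ j : Fin k, j.succ ≤ i → blockTime p q A B j < s := by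
      intro j hij
      rw [← hTi]
      exact (hT.monotone (Fin.castSucc_le_castSucc_iff.2 hij)).trans_lt hsi.1
    rw [h.geodesic_eq hp hq ⟨hs0.le, hs1.le⟩]
    have hnn : ∀ e, 0 ≤ calPath p q (X.blockVelocity p q A B) s e := fun e => le_max_left _ _
    constructor
    · intro e he
      rcases hE he with he' | ⟨j, he'⟩ | ⟨j, he'⟩
      · rw [calPath_common hp' hq' he' ⟨hs0.le, hs1.le⟩]
        have hpe := mul_nonneg (sub_nonneg.2 hs1.le) (hp' e)
        have hqe := mul_nonneg hs0.le (hq' e)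
        rcases mem_commonAxes.1 he' with h' | h' | h'
        · exact add_pos_of_pos_of_nonneg (mul_pos (sub_pos.2 hs1) h'.1) hqe
        · exact add_pos_of_pos_of_nonneg (mul_pos (sub_pos.2 hs1) h'.1) hqe
        · exact add_pos_of_nonneg_of_pos hpe (mul_pos hs0 h'.1)
      · exact (h.calPath_left_pos_iff he' s).2 (hlt j ((hA he').1 he))
      · exact (h.calPath_right_pos_iff he' s).2 (hgt j ((hB he').1 he))
    · intro e he
      refine le_antisymm (not_lt.1 fun hpos => he ?_) (hnn e)
      rcases h.cases hp' hq' e with he' | ⟨j, he'⟩ | ⟨j, he'⟩ | he'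
      · exact hC i he'
      · rw [h.calPath_left_pos_iff he'] at hpos
        exact (hA he').2 (not_le.1 fun hle => lt_asymm hpos (hgt j hle))
      · rw [h.calPath_right_pos_iff he'] at hpos
        exact (hB he').2 (not_lt.1 fun hle => lt_asymm hpos (hlt j hle))
      · exact absurd hpos (calPath_unused he'.2.2.2.1 he'.2.2.2.2.2 s).not_gt
  · rw [Fin.cons_succ]
    ext e
    rw [Finset.mem_sdiff]
    constructor
    · intro he
      rw [hA he, hA he]
      exact ⟨Fin.castSucc_lt_succ, lt_irrefl _⟩
    · rintro ⟨h1, h2⟩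
      rcases hE h1 with he | ⟨j, he⟩ | ⟨j, he⟩
      · exact absurd (hC _ he) h2
      · rw [hA he] at h1 h2
        have : j = i := by
          rw [Fin.lt_def] at h1 h2
          ext
          simp at h1 h2
          omega
        rwa [← this]
      · rw [hB he] at h1 h2
        exact absurd (h1.trans Fin.castSucc_lt_succ.le) h2
  · rw [Fin.cons_succ]
    ext e
    rw [Finset.mem_sdiff]
    constructor
    · intro he
      rw [hB he, hB he]
      exact ⟨le_rfl, not_le.2 Fin.castSucc_lt_succ⟩
    · rintro ⟨h1, h2⟩
      rcases hE h1 with he | ⟨j, he⟩ | ⟨j, he⟩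
      · exact absurd (hC _ he) h2
      · rw [hA he] at h1 h2
        exact absurd (Fin.castSucc_lt_succ.trans h1) h2
      · rw [hB he] at h1 h2
        have : j = i := by
          rw [Fin.le_def] at h1 h2
          ext
          simp at h1 h2
          omega
        rwa [← this]

end IsGeodesicBlocks

end OrthantSpace

/-! ### Conditions whose truth value settles as the parameter tends to zero from the right. -/

/-- The truth value of `P` is constant on some interval `(0, ε)`. -/
def EventuallyDecided (P : ℝ → Prop) : Prop :=
  (∀ᶠ lam in 𝓝[>] (0 : ℝ), P lam) ∨ ∀ᶠ lam in 𝓝[>] (0 : ℝ), ¬ P lam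

namespace EventuallyDecided

variable {P Q : ℝ → Prop}

theorem const (p : Prop) : EventuallyDecided fun _ => p := by
  by_cases hp : p
  · exact Or.inl (Eventually.of_forall fun _ => hp)
  · exact Or.inr (Eventually.of_forall fun _ => hp)

theorem not (h : EventuallyDecided P) : EventuallyDecided fun lam => ¬ P lam := by
  rcases h with h | h
  · exact Or.inr (h.mono fun _ h1 => not_not.2 h1)
  · exact Or.inl h

theorem forall_finite {ι : Type*} [Finite ι] {P : ι → ℝ → Prop}
    (h : ∀ i, EventuallyDecided (P i)) : EventuallyDecided fun lam => ∀ i, P i lam := by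
  by_cases hall : ∀ i, ∀ᶠ lam in 𝓝[>] (0 : ℝ), P i lam
  · exact Or.inl (eventually_all.2 hall)
  · obtain ⟨i, hi⟩ := not_forall.1 hall
    rcases h i with h' | h'
    · exact absurd h' hi
    · exact Or.inr (h'.mono fun _ h1 h2 => h1 (h2 i))

theorem and (hP : EventuallyDecided P) (hQ : EventuallyDecided Q) :
    EventuallyDecided fun lam => P lam ∧ Q lam := by
  rcases hP with hP | hP
  · rcases hQ with hQ | hQ
    · exact Or.inl (hP.and hQ)
    · exact Or.inr (hQ.mono fun _ h1 h2 => h1 h2.2)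
  · exact Or.inr (hP.mono fun _ h1 h2 => h1 h2.1)

theorem const_imp (p : Prop) (hQ : EventuallyDecided Q) :
    EventuallyDecided fun lam => p → Q lam := by
  by_cases hp : p
  · simpa [hp] using hQ
  · simpa [hp] using const True

/-- Near `0` an analytic function is identically zero or equals `z ^ n * g z` with `g 0 ≠ 0`; in the
second case its sign on some `(0, ε)` is that of `g 0`. -/
theorem pos {f : ℝ → ℝ} (hf : AnalyticAt ℝ f 0) : EventuallyDecided fun lam => 0 < f lam := by
  by_cases h0 : ∀ᶠ z in 𝓝 (0 : ℝ), f z = 0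
  · exact Or.inr ((h0.filter_mono nhdsWithin_le_nhds).mono fun z hz => by simp [hz])
  · obtain ⟨n, g, hg, hg0, hfg⟩ := hf.exists_eventuallyEq_pow_smul_nonzero_iff.2 h0
    rcases lt_or_gt_of_ne hg0 with hlt | hgt
    · right
      filter_upwards [nhdsWithin_le_nhds hfg, self_mem_nhdsWithin,
        nhdsWithin_le_nhds (hg.continuousAt.eventually (gt_mem_nhds hlt))] with z h1 h2 h3
      rw [h1, sub_zero, smul_eq_mul, not_lt]
      exact mul_nonpos_of_nonneg_of_nonpos (pow_nonneg (le_of_lt h2) n) (le_of_lt h3)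
    · left
      filter_upwards [nhdsWithin_le_nhds hfg, self_mem_nhdsWithin,
        nhdsWithin_le_nhds (hg.continuousAt.eventually (lt_mem_nhds hgt))] with z h1 h2 h3
      rw [h1, sub_zero, smul_eq_mul]
      exact mul_pos (pow_pos h2 n) h3

theorem lt {f g : ℝ → ℝ} (hf : AnalyticAt ℝ f 0) (hg : AnalyticAt ℝ g 0) :
    EventuallyDecided fun lam => f lam < g lam := by
  simpa using pos (hg.sub hf)

theorem le {f g : ℝ → ℝ} (hf : AnalyticAt ℝ f 0) (hg : AnalyticAt ℝ g 0) :
    EventuallyDecided fun lam => f lam ≤ g lam := by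
  simpa using (lt hg hf).not

theorem exists_eventually {ι : Type*} [Finite ι] {P : ι → ℝ → Prop}
    (h : ∀ i, EventuallyDecided (P i)) (hex : ∀ᶠ lam in 𝓝[>] (0 : ℝ), ∃ i, P i lam) :
    ∃ i, ∀ᶠ lam in 𝓝[>] (0 : ℝ), P i lam := by
  by_contra! hno
  have := eventually_all.2 fun i => (h i).resolve_left (not_eventually.2 (hno i))
  obtain ⟨lam, ⟨i, hi⟩, h2⟩ := (hex.and this).exists
  exact h2 i hi

end EventuallyDecided

/-! ### Block systems whose weights depend on a parameter. -/

section Blocks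

variable {ι : Type*} {R : ι → ι → Prop} {SA SB : Finset ι} {a : ℝ → ι → ℝ} {b : ι → ℝ} {k : ℕ}
  {A B : Fin k → Finset ι}

theorem IsBlockSystem.of_le {a a' b' : ι → ℝ} (h : IsBlockSystem R SA SB a b A B)
    (hm : ∀ i j, i < j →
      (∑ e ∈ A i, a' e) * ∑ f ∈ B j, b' f ≤ (∑ e ∈ A j, a' e) * ∑ f ∈ B i, b' f)
    (he : ∀ i, ∀ C ⊆ A i, ∀ D ⊆ B i, (∀ e ∈ C, ∀ f ∈ D, ¬ R e f) →
      (∑ e ∈ C, a' e) * ∑ f ∈ B i, b' f + (∑ f ∈ D, b' f) * ∑ e ∈ A i, a' e ≤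
        (∑ e ∈ A i, a' e) * ∑ f ∈ B i, b' f) : IsBlockSystem R SA SB a' b' A B :=
  ⟨h.left_nonempty, h.right_nonempty, h.left_cover, h.right_cover, h.left_disj, h.right_disj,
    h.indep, hm, he⟩

theorem eventuallyDecided_isBlockSystem [Finite ι] (ha : ∀ e, AnalyticAt ℝ (fun lam => a lam e) 0) :
    EventuallyDecided fun lam =>
      IsBlockSystem R SA SB (a lam) b A B ∧ BlocksStrict (a lam) b A B := by
  have hsum : ∀ S : Finset ι, AnalyticAt ℝ (fun lam => ∑ e ∈ S, a lam e) 0 := fun S =>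
    S.analyticAt_fun_sum fun e _ => ha e
  refine .and ?_ (.forall_finite fun i => .forall_finite fun j => .const_imp _
    (.lt ((hsum _).mul analyticAt_const) ((hsum _).mul analyticAt_const)))
  -- The combinatorial clauses do not involve `lam`: they either fail always, or hold always and
  -- leave only the inequalities to decide.
  by_cases hex : ∃ lam, IsBlockSystem R SA SB (a lam) b A B
  · obtain ⟨lam₀, h₀⟩ := hex
    have h1 : EventuallyDecided fun lam => ∀ i j, i < j → (∑ e ∈ A i, a lam e) * ∑ f ∈ B j, b f ≤
        (∑ e ∈ A j, a lam e) * ∑ f ∈ B i, b f :=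
      .forall_finite fun i => .forall_finite fun j => .const_imp _
        (.le ((hsum _).mul analyticAt_const) ((hsum _).mul analyticAt_const))
    have h2 : EventuallyDecided fun lam => ∀ i, ∀ C, C ⊆ A i → ∀ D, D ⊆ B i →
        (∀ e ∈ C, ∀ f ∈ D, ¬ R e f) →
        (∑ e ∈ C, a lam e) * ∑ f ∈ B i, b f + (∑ f ∈ D, b f) * ∑ e ∈ A i, a lam e ≤
          (∑ e ∈ A i, a lam e) * ∑ f ∈ B i, b f :=
      .forall_finite fun i => .forall_finite fun C => .const_imp _ (.forall_finite fun D =>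
        .const_imp _ (.const_imp _ (.le (((hsum _).mul analyticAt_const).add
          (analyticAt_const.mul (hsum _))) ((hsum _).mul analyticAt_const))))
    have h3 : (fun lam => IsBlockSystem R SA SB (a lam) b A B) = fun lam =>
        (∀ i j, i < j → (∑ e ∈ A i, a lam e) * ∑ f ∈ B j, b f ≤
          (∑ e ∈ A j, a lam e) * ∑ f ∈ B i, b f) ∧
        ∀ i, ∀ C, C ⊆ A i → ∀ D, D ⊆ B i → (∀ e ∈ C, ∀ f ∈ D, ¬ R e f) →
        (∑ e ∈ C, a lam e) * ∑ f ∈ B i, b f + (∑ f ∈ D, b f) * ∑ e ∈ A i, a lam e ≤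
          (∑ e ∈ A i, a lam e) * ∑ f ∈ B i, b f := by
      funext lam
      exact propext ⟨fun h => ⟨h.mono, h.extremal⟩, fun h => h₀.of_le h.1 h.2⟩
    rw [h3]
    exact h1.and h2
  · exact Or.inr (Eventually.of_forall fun lam h => hex ⟨lam, h⟩)

/-- Only weak inequalities depend on the weights, and these pass to the limit; blocks of equal ratio
may result. -/
theorem isBlockSystem_of_eventually (ha : ∀ e, ContinuousAt (fun lam => a lam e) 0)
    (h : ∀ᶠ lam in 𝓝[>] (0 : ℝ), IsBlockSystem R SA SB (a lam) b A B) :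
    IsBlockSystem R SA SB (a 0) b A B := by
  have hsum : ∀ S : Finset ι, Tendsto (fun lam => ∑ e ∈ S, a lam e) (𝓝[>] 0)
      (𝓝 (∑ e ∈ S, a 0 e)) := fun S =>
    tendsto_finsetSum S fun e _ => (ha e).tendsto.mono_left nhdsWithin_le_nhds
  obtain ⟨lam₀, h₀⟩ := h.exists
  refine h₀.of_le (fun i j hij => ?_) (fun i C hC D hD hind => ?_)
  · exact le_of_tendsto_of_tendsto ((hsum _).mul_const _) ((hsum _).mul_const _)
      (h.mono fun lam hl => hl.mono i j hij)
  · exact le_of_tendsto_of_tendsto (((hsum _).mul_const _).add ((hsum _).const_mul _))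
      ((hsum _).mul_const _) (h.mono fun lam hl => hl.extremal i C hC D hD hind)

end Blocks

/-! ### Limits of normalised blocks, and points along short geodesics. -/

theorem coordProj_add_smul {M : ℕ} (S : Finset (Fin M)) (p w : EuclideanSpace ℝ (Fin M)) (lam : ℝ) :
    coordProj S (p + lam • w) = coordProj S p + lam • coordProj S w := by
  ext e
  by_cases he : e ∈ S <;> simp [coordProj_apply, he]

theorem tendsto_coordProj {M : ℕ} (S : Finset (Fin M)) (p w : EuclideanSpace ℝ (Fin M)) :
    Tendsto (fun lam : ℝ => coordProj S (p + lam • w)) (𝓝[>] 0) (𝓝 (coordProj S p)) := by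
  have h : ContinuousAt (fun lam : ℝ => coordProj S p + lam • coordProj S w) 0 := by fun_prop
  have h' := h.tendsto.mono_left (nhdsWithin_le_nhds (s := Set.Ioi 0))
  simpa only [coordProj_add_smul, zero_smul, add_zero] using h'

theorem coordProj_eq_zero_iff {M : ℕ} {S : Finset (Fin M)} {p : EuclideanSpace ℝ (Fin M)} :
    coordProj S p = 0 ↔ ∀ e ∈ S, p e = 0 := by
  constructor
  · intro h e he
    have := congrArg (fun v : EuclideanSpace ℝ (Fin M) => v e) h
    simpa [coordProj_apply, he] using this
  · intro h
    ext e
    by_cases he : e ∈ S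
    · simp [coordProj_apply, he, h e he]
    · simp [coordProj_apply, he]

/-- If `S` meets `E`, then `coordProj S p` is non-zero and is the limit of the block. Otherwise `p`
vanishes on `S`, and the factor `lam` cancels between the vector and its norm. -/
theorem limitBlock_spec {M : ℕ} {E F S : Finset (Fin M)} {p w : EuclideanSpace ℝ (Fin M)}
    (hp : p ∈ openOrthant E) (hw : w ∈ tangentStratum E F) (hS : S ⊆ E ∪ F) (hne : S.Nonempty)
    (c : ℝ) : limitBlock E F p w S ≠ 0 ∧
      Tendsto (fun lam : ℝ => (c / ‖coordProj S (p + lam • w)‖) • coordProj S (p + lam • w))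
        (𝓝[>] 0) (𝓝 ((c / ‖limitBlock E F p w S‖) • limitBlock E F p w S)) := by
  by_cases h0 : coordProj (S ∩ E) p = 0
  · have hSE : ∀ e ∈ S, e ∉ E := fun e he hE =>
      (hp.1 e hE).ne' (coordProj_eq_zero_iff.1 h0 e (Finset.mem_inter.2 ⟨he, hE⟩))
    have hSF : S ⊆ F := fun e he => (Finset.mem_union.1 (hS he)).resolve_left (hSE e he)
    have hW : limitBlock E F p w S = coordProj S w := by
      rw [limitBlock, if_pos h0, Finset.inter_eq_left.2 hSF]
    have hpS : coordProj S p = 0 := coordProj_eq_zero_iff.2 fun e he => hp.2 e (hSE e he)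
    rw [hW]
    refine ⟨fun hz => ?_, tendsto_const_nhds.congr' ?_⟩
    · obtain ⟨e, he⟩ := hne
      exact (hw.1 e (hSF he)).ne' (coordProj_eq_zero_iff.1 hz e he)
    · filter_upwards [self_mem_nhdsWithin] with lam hlam
      have hlam' : 0 < lam := hlam
      rw [coordProj_add_smul, hpS, zero_add, norm_smul, Real.norm_of_nonneg hlam'.le, smul_smul]
      congr 1
      field_simp
  · have hW : limitBlock E F p w S = coordProj S p := by
      rw [limitBlock, if_neg h0]
      ext e
      by_cases heE : e ∈ E <;> by_cases heS : e ∈ S <;> simp [coordProj_apply, heE, heS]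
      exact (hp.2 e heE).symm
    have hne' : coordProj S p ≠ 0 := by
      rw [← hW, limitBlock, if_neg h0]; exact h0
    rw [hW]
    have ht := tendsto_coordProj S p w
    exact ⟨hne', (tendsto_const_nhds.div ht.norm (norm_ne_zero_iff.2 hne')).smul ht⟩

namespace OrthantSpace

variable {M m : ℕ} {X : OrthantSpace M m}

/-- The equality case of the triangle inequality: the bounds give `‖t • a - s • b‖ ^ 2 ≤ 0`. -/
theorem smul_eq_of_norm_le {V : Type*} [NormedAddCommGroup V] [InnerProductSpace ℝ V] {a b : V}
    {s t c : ℝ} (hs : 0 ≤ s) (ht : 0 ≤ t) (ha : ‖a‖ ≤ s * c) (hb : ‖b‖ ≤ t * c)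
    (hab : ‖a + b‖ = (s + t) * c) : t • a = s • b := by
  rw [← sub_eq_zero, ← norm_eq_zero, ← pow_eq_zero_iff two_ne_zero]
  refine le_antisymm ?_ (sq_nonneg _)
  have h1 := norm_add_sq_real a b
  rw [norm_sub_sq_real, norm_smul, norm_smul, real_inner_smul_left, real_inner_smul_right,
    Real.norm_of_nonneg hs, Real.norm_of_nonneg ht]
  rw [hab] at h1
  have h2 := pow_le_pow_left₀ (norm_nonneg a) ha 2
  have h3 := pow_le_pow_left₀ (norm_nonneg b) hb 2
  have h4 : (t * ‖a‖) ^ 2 - 2 * (t * (s * inner ℝ a b)) + (s * ‖b‖) ^ 2 =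
      t * (s + t) * ‖a‖ ^ 2 + s * (s + t) * ‖b‖ ^ 2 - s * t * ((s + t) * c) ^ 2 := by
    rw [h1]; ring
  rw [h4]
  have h5 := mul_le_mul_of_nonneg_left h2 (mul_nonneg ht (add_nonneg hs ht))
  have h6 := mul_le_mul_of_nonneg_left h3 (mul_nonneg hs (add_nonneg hs ht))
  nlinarith

/-- Since `pointAlong` is a choice, every geodesic with initial vector `w` has to be shown to end at
`p + lam • w`. For small `lam` its end lies in a ball on which the coordinates in `E` stay positive,
hence in a common closed orthant with `p`. There the distance is Euclidean, the geodesic is the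
straight segment, and its derivative at `0` identifies it. -/
theorem eventually_pointAlong {E F : Finset (Fin M)} (hEF : E ∪ F ∈ X.strata)
    {p w : EuclideanSpace ℝ (Fin M)} (hp : p ∈ openOrthant E) (hw : w ∈ tangentStratum E F) :
    ∀ᶠ lam in 𝓝[>] (0 : ℝ), X.pointAlong p lam w = p + lam • w ∧
      p + lam • w ∈ openOrthant (E ∪ F) := by
  have hpos : ∀ᶠ q in 𝓝 p, ∀ e ∈ E, 0 < q e := by
    rw [E.eventually_all]
    intro e he
    have hc : ContinuousAt (fun q : EuclideanSpace ℝ (Fin M) => q e) p := by fun_prop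
    exact hc.eventually (lt_mem_nhds (hp.1 e he))
  obtain ⟨δ, hδ, hball⟩ := Metric.eventually_nhds_iff.1 hpos
  have hsmall : ∀ᶠ lam in 𝓝[>] (0 : ℝ), lam * ‖w‖ < δ := by
    have hc : ContinuousAt (fun lam : ℝ => lam * ‖w‖) 0 := by fun_prop
    exact nhdsWithin_le_nhds (hc.eventually (gt_mem_nhds (by simpa using hδ)))
  filter_upwards [hsmall, self_mem_nhdsWithin] with lam hlam hlam0
  have hlam0' : 0 < lam := hlam0
  have hE : ∀ s ∈ Set.Icc 0 lam, ∀ e ∈ E, 0 < (p + s • w) e := by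
    intro s hs
    refine hball ?_
    rw [dist_eq_norm, add_sub_cancel_left, norm_smul, Real.norm_of_nonneg hs.1]
    exact (mul_le_mul_of_nonneg_right hs.2 (norm_nonneg w)).trans_lt hlam
  have hout : ∀ s : ℝ, ∀ e ∉ E ∪ F, (p + s • w) e = 0 := by
    intro s e he
    have h1 := hp.2 e fun h => he (Finset.mem_union_left _ h)
    simp [h1, hw.2 e he]
  have hF : ∀ s : ℝ, ∀ e ∈ F, e ∉ E → (p + s • w) e = s * w e := by
    intro s e _ heE
    simp [hp.2 e heE]
  have hnn : ∀ s ∈ Set.Icc 0 lam, ∀ e, 0 ≤ (p + s • w) e := by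
    intro s hs e
    by_cases heE : e ∈ E
    · exact (hE s hs e heE).le
    by_cases heF : e ∈ F
    · rw [hF s e heF heE]; exact mul_nonneg hs.1 (hw.1 e heF).le
    · exact (hout s e (by simp [heE, heF])).ge
  have hsub : ∀ s : ℝ, posAxes (p + s • w) ⊆ E ∪ F := by
    intro s e he
    by_contra hne
    rw [mem_posAxes, hout s e hne] at he
    exact lt_irrefl _ he
  have hseg : ∀ s ∈ Set.Icc 0 lam, ∀ t ∈ Set.Icc 0 lam,
      segment ℝ (p + s • w) (p + t • w) ⊆ X.carrier := fun s hs t ht =>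
    segment_subset_carrier (hnn s hs) (hnn t ht)
      (X.closure_mem _ hEF _ (Finset.union_subset (hsub s) (hsub t)))
  have hmem : p + lam • w ∈ openOrthant (E ∪ F) := by
    refine ⟨fun e he => ?_, hout lam⟩
    by_cases heE : e ∈ E
    · exact hE lam ⟨hlam0'.le, le_rfl⟩ e heE
    · have heF := (Finset.mem_union.1 he).resolve_left heE
      rw [hF lam e heF heE]; exact mul_pos hlam0' (hw.1 e heF)
  refine ⟨?_, hmem⟩
  have hspec := Classical.epsilon_spec
    (p := fun q => ∃ γ : ℝ → EuclideanSpace ℝ (Fin M),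
      X.IsGeodesicOn γ lam ‖w‖ ∧ γ 0 = p ∧ HasDerivWithinAt γ w (Set.Icc 0 lam) 0 ∧ γ lam = q)
    ⟨p + lam • w, fun s => p + s • w, ⟨fun s hs => hseg s hs s hs (left_mem_segment ℝ _ _),
      fun s hs t ht => by
        rw [idist_eq_norm_sub (hseg s hs t ht), add_sub_add_left_eq_sub, ← sub_smul, norm_smul,
          Real.norm_eq_abs, abs_sub_comm, mul_comm]⟩, by simp, by
        simpa using ((hasDerivAt_id (0 : ℝ)).smul_const w).const_add p |>.hasDerivWithinAt, rfl⟩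
  change ∃ γ : ℝ → EuclideanSpace ℝ (Fin M), X.IsGeodesicOn γ lam ‖w‖ ∧ γ 0 = p ∧
    HasDerivWithinAt γ w (Set.Icc 0 lam) 0 ∧ γ lam = X.pointAlong p lam w at hspec
  obtain ⟨γ, hγ, h0, hd, h1⟩ := hspec
  set q := X.pointAlong p lam w
  have m0 : (0 : ℝ) ∈ Set.Icc 0 lam := ⟨le_rfl, hlam0'.le⟩
  have m1 : lam ∈ Set.Icc 0 lam := ⟨hlam0'.le, le_rfl⟩
  have hpc := hγ.1 0 m0
  have hqc := hγ.1 lam m1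
  have hdist := hγ.2 0 m0 lam m1
  rw [h0] at hpc
  rw [h1] at hqc
  rw [h0, h1, zero_sub, abs_neg, abs_of_pos hlam0'] at hdist
  have hqE : ∀ e ∈ E, 0 < q e := by
    refine hball ?_
    rw [dist_eq_norm]
    refine (norm_sub_le_idist hpc hqc).trans_lt ?_
    rwa [hdist, mul_comm]
  have hpq : segment ℝ p q ⊆ X.carrier := by
    have hq' := X.mem_carrier_iff.1 hqc
    refine segment_subset_carrier (X.mem_carrier_iff.1 hpc).1 hq'.1 ?_
    rw [posAxes_eq_of_mem hp, Finset.union_eq_right.2 fun e he => mem_posAxes.2 (hqE e he)]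
    exact hq'.2
  rw [idist_eq_norm_sub hpq] at hdist
  have hlin : ∀ s ∈ Set.Icc 0 lam, γ s = p + s • (lam⁻¹ • (q - p)) := by
    intro s hs
    have d1 := norm_sub_le_idist hpc (hγ.1 s hs)
    have d2 := norm_sub_le_idist (hγ.1 s hs) hqc
    have e1 := hγ.2 0 m0 s hs
    have e2 := hγ.2 s hs lam m1
    rw [h0, zero_sub, abs_neg, abs_of_nonneg hs.1] at e1
    rw [h1, abs_sub_comm, abs_of_nonneg (sub_nonneg.2 hs.2)] at e2
    rw [e1, mul_comm] at d1
    rw [e2, mul_comm] at d2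
    -- The chords `γ s - p` and `q - γ s` are no longer than the corresponding arcs, while their sum
    -- has the full length.
    have key := smul_eq_of_norm_le hs.1 (sub_nonneg.2 hs.2) d1 d2 (by
      rw [add_comm, sub_add_sub_cancel, hdist]; ring)
    have key2 : lam • (γ s - p) = s • (q - p) := by
      have : lam • (γ s - p) = (lam - s) • (γ s - p) + s • (γ s - p) := by
        rw [← add_smul, sub_add_cancel]
      rw [this, key, ← smul_add, sub_add_sub_cancel]
    rw [smul_comm, ← key2, smul_smul, inv_mul_cancel₀ hlam0'.ne', one_smul, add_sub_cancel]
  have hd2 : HasDerivWithinAt γ (lam⁻¹ • (q - p)) (Set.Icc 0 lam) 0 := by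
    have hd3 : HasDerivWithinAt (fun s : ℝ => p + s • (lam⁻¹ • (q - p))) (lam⁻¹ • (q - p))
        (Set.Icc 0 lam) 0 := by
      simpa using ((hasDerivAt_id (0 : ℝ)).smul_const (lam⁻¹ • (q - p))).const_add p
        |>.hasDerivWithinAt
    exact hd3.congr hlin (hlin 0 m0)
  have hw' := (uniqueDiffOn_Icc hlam0' 0 m0).eq_deriv _ hd hd2
  rw [hw', smul_smul, mul_inv_cancel₀ hlam0'.ne', one_smul, add_sub_cancel]

theorem commonAxes_congr {p p' : EuclideanSpace ℝ (Fin M)} (h : posAxes p = posAxes p')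
    (q : EuclideanSpace ℝ (Fin M)) : X.commonAxes p q = X.commonAxes p' q := by
  simp only [commonAxes, h]

/-- The blocks of the geodesic from `p + lam • w` to `x` do not depend on small `lam > 0`. -/
theorem exists_eventually_isGeodesicBlocks {E F : Finset (Fin M)} (hEF : E ∪ F ∈ X.strata)
    {p w x : EuclideanSpace ℝ (Fin M)} (hp : p ∈ openOrthant E) (hw : w ∈ tangentStratum E F)
    (hx : x ∈ X.carrier) : ∃ (k : ℕ) (A B : Fin k → Finset (Fin M)),
      (∀ᶠ lam in 𝓝[>] (0 : ℝ), X.IsGeodesicBlocks (p + lam • w) x A B ∧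
        BlocksStrict (fun e => (p + lam • w) e ^ 2) (fun f => x f ^ 2) A B) := by
  have hev := eventually_pointAlong hEF hp hw
  obtain ⟨lam₀, hlam₀⟩ := hev.exists
  -- The common axes depend on the first point only through its stratum, hence not on small `lam >
  -- 0`.
  set c := X.commonAxes (p + lam₀ • w) x with hc
  have hcommon : ∀ lam : ℝ, p + lam • w ∈ openOrthant (E ∪ F) →
      posAxes (p + lam • w) = E ∪ F ∧ X.commonAxes (p + lam • w) x = c := fun lam hlam =>
    ⟨posAxes_eq_of_mem hlam, commonAxes_congr
      ((posAxes_eq_of_mem hlam).trans (posAxes_eq_of_mem hlam₀.2).symm) x⟩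
  -- The candidates form a finite type, because at most `M` blocks are needed.
  have hdec : ∀ i : (Σ k : Fin (M + 1), (Fin k → Finset (Fin M)) × (Fin k → Finset (Fin M))),
      EventuallyDecided fun lam => IsBlockSystem (fun e f => {e, f} ∉ X.strata) ((E ∪ F) \ c)
        (posAxes x \ c) (fun e => (p + lam • w) e ^ 2) (fun f => x f ^ 2) i.2.1 i.2.2 ∧
        BlocksStrict (fun e => (p + lam • w) e ^ 2) (fun f => x f ^ 2) i.2.1 i.2.2 := fun i =>
    eventuallyDecided_isBlockSystem (a := fun lam e => (p + lam • w) e ^ 2) fun e => by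
      simp only [PiLp.add_apply, PiLp.smul_apply, smul_eq_mul]
      fun_prop
  obtain ⟨⟨k, A, B⟩, hi⟩ := EventuallyDecided.exists_eventually hdec (by
    filter_upwards [hev] with lam hlam
    have hmem : p + lam • w ∈ X.carrier :=
      X.mem_carrier_iff.2 ⟨nonneg_of_mem_openOrthant hlam.2, by
        rw [posAxes_eq_of_mem hlam.2]; exact hEF⟩
    obtain ⟨k, A, B, hk, h, hs⟩ := exists_isGeodesicBlocks hmem hx
    rw [IsGeodesicBlocks, (hcommon lam hlam.2).1, (hcommon lam hlam.2).2] at h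
    exact ⟨⟨⟨k, Nat.lt_succ_of_le hk⟩, A, B⟩, h, hs⟩)
  refine ⟨k, A, B, ?_⟩
  filter_upwards [hi, hev] with lam h hlam
  rw [IsGeodesicBlocks, (hcommon lam hlam.2).1, (hcommon lam hlam.2).2]
  exact h

end OrthantSpace

/-! ### The limits along the stratum and into a larger stratum. -/

open OrthantSpace

theorem theorem2 {M m : ℕ} (X : OrthantSpace M m) (E : Finset (Fin M)) (hE : E ∈ X.strata)
    (xs : EuclideanSpace ℝ (Fin M)) (hxs : xs ∈ openOrthant E)
    (x : EuclideanSpace ℝ (Fin M)) (hx : x ∈ X.carrier) :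
    (∀ w ∈ coordSpan E,
      Tendsto (fun lam : ℝ => X.translatedLog x (X.pointAlong xs lam w)) (𝓝[>] 0)
        (𝓝 (X.translatedLog x xs))) ∧
    (∀ F : Finset (Fin M), F.Nonempty → Disjoint E F → E ∪ F ∈ X.strata →
      ∀ w ∈ tangentStratum E F,
        ∃ Psi : EuclideanSpace ℝ (Fin M),
          Tendsto (fun lam : ℝ => X.translatedLog x (X.pointAlong xs lam w)) (𝓝[>] 0) (𝓝 Psi) ∧
          ∃ (ε : ℝ) (k : ℕ) (A B : Fin (k + 1) → Finset (Fin M)), 0 < ε ∧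
            (∀ lam ∈ Set.Ioo 0 ε, X.IsSupport (X.pointAlong xs lam w) x A B) ∧
            (∀ i : Fin k, limitBlock E F xs w (A i.succ) ≠ 0) ∧
            Psi = coordProj (B 0) x - ∑ i : Fin k,
              (‖coordProj (B i.succ) x‖ / ‖limitBlock E F xs w (A i.succ)‖) •
                limitBlock E F xs w (A i.succ)) := by
  have hmem : ∀ {G : Finset (Fin M)} {y}, G ∈ X.strata → y ∈ openOrthant G → y ∈ X.carrier :=
    fun hG hy => X.mem_carrier_iff.2
      ⟨nonneg_of_mem_openOrthant hy, by rwa [posAxes_eq_of_mem hy]⟩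
  constructor
  · intro w hw
    -- Motion inside the stratum is the case `F = ∅` of the results above.
    have hE' : E ∪ ∅ ∈ X.strata := by rwa [Finset.union_empty]
    have hw' : w ∈ tangentStratum E ∅ := ⟨by simp, fun i hi => hw i (by simpa using hi)⟩
    have hev := eventually_pointAlong hE' hxs hw'
    obtain ⟨k, A, B, hAB⟩ := exists_eventually_isGeodesicBlocks hE' hxs hw' hx
    have hpos : ∀ lam : ℝ, xs + lam • w ∈ openOrthant (E ∪ ∅) →
        posAxes (xs + lam • w) = posAxes xs := fun lam h => by
      rw [posAxes_eq_of_mem h, posAxes_eq_of_mem hxs, Finset.union_empty]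
    -- The stratum is the same at `lam = 0`, so the blocks survive the limit. Strictness of the
    -- ratios may be lost, but the formula for `Φ` does not need it.
    have h0 : X.IsGeodesicBlocks xs x A B := by
      have := isBlockSystem_of_eventually (R := fun e f => {e, f} ∉ X.strata)
        (SA := posAxes xs \ X.commonAxes xs x) (SB := posAxes x \ X.commonAxes xs x)
        (a := fun lam e => (xs + lam • w) e ^ 2) (b := fun f => x f ^ 2) (A := A) (B := B)
        (fun e => by
          simp only [PiLp.add_apply, PiLp.smul_apply, smul_eq_mul]
          fun_prop)
        (by
          filter_upwards [hAB, hev] with lam h hlam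
          have h1 := h.1
          rwa [IsGeodesicBlocks, commonAxes_congr (hpos lam hlam.2), hpos lam hlam.2] at h1)
      rw [IsGeodesicBlocks]
      simpa only [zero_smul, add_zero] using this
    rw [h0.translatedLog_eq (hmem hE hxs) hx]
    have hlim : Tendsto (fun lam : ℝ => coordProj (X.commonAxes xs x) x -
        ∑ i, (‖coordProj (B i) x‖ / ‖coordProj (A i) (xs + lam • w)‖) •
          coordProj (A i) (xs + lam • w)) (𝓝[>] 0) (𝓝 (coordProj (X.commonAxes xs x) x -
        ∑ i, (‖coordProj (B i) x‖ / ‖coordProj (A i) xs‖) • coordProj (A i) xs)) :=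
      tendsto_const_nhds.sub (tendsto_finsetSum _ fun i _ =>
        (tendsto_const_nhds.div (tendsto_coordProj (A i) xs w).norm (h0.norm_left_pos i).ne').smul
          (tendsto_coordProj (A i) xs w))
    refine hlim.congr' ?_
    filter_upwards [hAB, hev] with lam h hlam
    rw [hlam.1, h.1.translatedLog_eq (hmem hE' hlam.2) hx, commonAxes_congr (hpos lam hlam.2)]
  · intro F _ _ hEF w hw
    have hev := eventually_pointAlong hEF hxs hw
    obtain ⟨k, A, B, hAB⟩ := exists_eventually_isGeodesicBlocks hEF hxs hw hx
    obtain ⟨lam₀, h₀, hlam₀⟩ := (hAB.and hev).exists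
    set c := X.commonAxes (xs + lam₀ • w) x with hc
    have hcommon : ∀ lam : ℝ, xs + lam • w ∈ openOrthant (E ∪ F) →
        X.commonAxes (xs + lam • w) x = c := fun lam hlam => commonAxes_congr
      ((posAxes_eq_of_mem hlam).trans (posAxes_eq_of_mem hlam₀.2).symm) x
    have hblock := fun i => limitBlock_spec hxs hw (S := A i) (fun e he => by
      have := mem_posAxes.2 (h₀.1.mem_left he).1
      rwa [posAxes_eq_of_mem hlam₀.2] at this) (h₀.1.left_nonempty i) ‖coordProj (B i) x‖
    -- One `ε` on which the blocks are valid and `pointAlong` is `xs + lam • w`.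
    obtain ⟨ε, hε, hsub⟩ := mem_nhdsGT_iff_exists_Ioo_subset.1 (hAB.and hev)
    refine ⟨coordProj c x - ∑ i, (‖coordProj (B i) x‖ / ‖limitBlock E F xs w (A i)‖) •
        limitBlock E F xs w (A i), ?_, ε, k, Fin.cons c A, Fin.cons c B, hε, ?_, ?_, ?_⟩
    · refine (tendsto_const_nhds.sub (tendsto_finsetSum _ fun i _ => (hblock i).2)).congr' ?_
      filter_upwards [hAB, hev] with lam h hlam
      rw [hlam.1, h.1.translatedLog_eq (hmem hEF hlam.2) hx, hcommon lam hlam.2]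
    · intro lam hlam
      obtain ⟨h, h1, h2⟩ := hsub hlam
      have := h.1.isSupport h.2 (hmem hEF h2) hx
      rwa [h1, ← hcommon lam h2]
    · exact fun i => by simpa using (hblock i).1
    · simp

end
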